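/- Let $n\ge 1$, let $\theta_1,\dots,\theta_{n+3}\in\mathbb C\setminus\mathbb Z$, put $\rho=-\frac12\sum_{j=1}^{n+3}\theta_j$, and put $t_{n+1}=0$, $t_{n+2}=1$. Let $U\subset\mathbb C^n$ be an open set of points $t=(t_1,\dots,t_n)$ for which $t_1,\dots,t_{n+2}$ are pairwise distinct, and let $A_j=\begin{pmatrix}a_j&b_j\\c_j&d_j\end{pmatrix}$ $(j=1,\dots,n+2)$ be a solution on $U$ of the Schlesinger system $$dA_j=\sum_{i\ne j}[A_i,A_j]\,d\log(t_j-t_i),\qquad \det A_j=0,\quad \operatorname{tr}A_j=\theta_j,\quad -\sum_{j=1}^{n+2}A_j=\operatorname{diag}(\rho,\rho+\theta_{n+3}).$$ Schlesinger transformations and Hamiltonians. For $\nu\in\mathbb Z^{n+3}$ with $\nu_1+\dots+\nu_{n+3}$ even, $T_\nu$ denotes the Schlesinger transformation: $T_\nu(\theta_j)=\theta_j+\nu_j$, and the matrices $T_\nu(A_j)$ satisfy the same algebraic conditions (on determinants, traces and the sum) with $\theta_j$ replaced by $\theta_j+\nu_j$, and there is an invertible $2\times2$ matrix $R(z)$ of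 rational functions of $z$ such that $Y\mapsto RY$ carries $\frac{dY}{dz}=\sum_j\frac{A_j}{z-t_j}Y$ to $\frac{dY}{dz}=\sum_j\frac{T_\nu(A_j)}{z-t_j}Y$ (this determines the $T_\nu(A_j)$ up to a simultaneous conjugation by a diagonal matrix). For $i=1,\dots,n$ let $$H_i=\sum_{j\ne i,\,j\le n+2}\frac{\operatorname{tr}A_iA_j+C_{ij}}{t_i-t_j},\qquad C_{ij}=-\frac{\theta_i\theta_j}2+\frac{\theta_i^2+\theta_j^2}{2(n+1)}-\frac{\sum_{k=1}^{n+3}\theta_k^2}{2(n+1)(n+2)},$$ and let $T_\nu(H_i)$ be the same expression formed with $T_\nu(A_j)$ and $\theta_j+\nu_j$. Garnier variables. Put $$x_i=\frac{t_i}{t_i-1},\qquad q_i=\frac{t_ib_i}{b_\infty},\qquad p_i=\frac{b_\infty}{t_i}\Big\{\frac{a_i}{b_i}+(t_i-1)\frac{a_{n+1}}{b_{n+1}}-t_i\frac{a_{n+2}}{b_{n+2}}\Big\},\qquad b_\infty=\sum_{j=1}^{n+2}t_jb_j,$$ and $\varepsilon_1=\theta_{n+1}$, $\varepsilon_2=\theta_{n+2}$,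 $\varepsilon_3=\theta_{n+3}+1$, $\varepsilon_{j}=\theta_{j-3}$ $(4\le j\le n+3)$. The Garnier Hamiltonians $\bar H_i$ are defined by $-(x_i-1)^2\bar H_i=T_{\mathbf e_{n+3}-\mathbf e_{n+1}}(H_i)$. For $\mu\in\mathbb Z^{n+3}$ with even coordinate sum let $\bar\tau_\mu$ be a nowhere vanishing function of $x=(x_1,\dots,x_n)$ with $$d\log\bar\tau_\mu=\sum_{i=1}^nT_\mu(\bar H_i)\,dx_i,$$ where the label $\mu$ refers to the order of the $\varepsilon_j$ ($\mu_j$ is the shift of $\varepsilon_j$), so that $-(x_i-1)^2T_\mu(\bar H_i)=T_{\mu'+\mathbf e_{n+3}-\mathbf e_{n+1}}(H_i)$ with $\mu'=(\mu_4,\dots,\mu_{n+3},\mu_1,\mu_2,\mu_3)$. Write $\bar\tau_{1,\pm3}=\bar\tau_{\mathbf e_1\pm\mathbf e_3}$ and $\bar\tau_{1,-2}=\bar\tau_{\mathbf e_1-\mathbf e_2}$. Assume that the Schlesinger transforms entering $\bar\tau_0,\bar\tau_{1,3},\bar\tau_{1,-3},\bar\tau_{1,-2}$ exist on $U$. Then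 for $i=1,\dots,n$, wherever the left-hand sides are defined ($b_\infty\neq0$ for the first, and in addition $b_i,b_{n+1},b_{n+2}\ne0$ for the second), $$q_i=-\frac1{\varepsilon_3}\,x_i(x_i-1)\frac{\partial}{\partial x_i}\log\frac{\bar\tau_{1,3}}{\bar\tau_{1,-3}}-2\bar X_i,$$ $$q_ip_i=-x_i\frac{\partial}{\partial x_i}\log\frac{\bar\tau_{1,-2}}{\bar\tau_0}+\frac{\bar\varGamma^{\,i+3}_{-1}-x_i\bar\varGamma^{\,i+3}_{-2}-(\varepsilon_1-\varepsilon_2)\bar X_i}{x_i-1},$$ where $\bar\varGamma^{\,i}_{-k}=-\frac{\varepsilon_i}2+\frac{1-2\varepsilon_k}{2(n+1)}$ and $$\bar X_i=\sum_{j\neq i,\,j\le n+2}\frac{x_i(x_j-1)}{(n+1)(n+2)(x_i-x_j)}\quad\text{with }x_{n+1}=0,\ x_{n+2}=\infty,$$ that is, $\bar X_i=\frac1{(n+1)(n+2)}\Big(\sum_{j\ne i,\,j\le n}\frac{x_i(x_j-1)}{x_i-x_j}-1-x_i\Big)$. -/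

import Mathlib

open Polynomial

noncomputable section

namespace Garnier

/-! Indices are 0-based: `Fin n` for `t_1, …, t_n`, `Fin (n+2)` for the finite singular points
`t_1, …, t_n, t_{n+1} = 0, t_{n+2} = 1`, and `Fin (n+3)` for the parameters
`θ_1, …, θ_{n+3}` (the last one belongs to `t_{n+3} = ∞`). -/

/-- `2 × 2` complex matrices. -/
abbrev Mat2 : Type := Matrix (Fin 2) (Fin 2) ℂ

variable {n : ℕ}

/-- `t_1, …, t_n` as indices among the finite singular points. -/
def mov (i : Fin n) : Fin (n + 2) := Fin.castAdd 2 i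

/-- The index `n+1` of the singular point `0`. -/
def idxZero (n : ℕ) : Fin (n + 2) := Fin.natAdd n 0

/-- The index `n+2` of the singular point `1`. -/
def idxOne (n : ℕ) : Fin (n + 2) := Fin.natAdd n 1

/-- The finite singular points `t_1, …, t_n, 0, 1`. -/
def pt (t : Fin n → ℂ) : Fin (n + 2) → ℂ := Fin.append t ![0, 1]

/-- The differentials `dt_1, …, dt_n, dt_{n+1} = 0, dt_{n+2} = 0`. -/
def dpt (n : ℕ) : Fin (n + 2) → ((Fin n → ℂ) →L[ℂ] ℂ) :=
  Fin.append (fun k => ContinuousLinearMap.proj k) ![0, 0]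

/-- `ρ = - (θ_1 + … + θ_{n+3}) / 2`. -/
def rho (θ : Fin (n + 3) → ℂ) : ℂ := -(∑ j, θ j) / 2

/-- The algebraic conditions on the residue matrices: `det A_j = 0`, `tr A_j = θ_j` and
`- ∑ A_j = diag (ρ, ρ + θ_{n+3})`. -/
structure IsResidueData (θ : Fin (n + 3) → ℂ) (A : Fin (n + 2) → Mat2) : Prop where
  det_eq : ∀ j, (A j).det = 0
  trace_eq : ∀ j, (A j).trace = θ j.castSucc
  sum_eq : -∑ j, A j = Matrix.diagonal ![rho θ, rho θ + θ (Fin.last (n + 2))]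

/-- `A` solves the Schlesinger system
`dA_j = ∑_{i ≠ j} [A_i, A_j] d log (t_j - t_i)` on the set `U` (entry by entry). -/
structure IsSchlesingerSolution (θ : Fin (n + 3) → ℂ) (U : Set (Fin n → ℂ))
    (A : (Fin n → ℂ) → Fin (n + 2) → Mat2) : Prop where
  residueData : ∀ t ∈ U, IsResidueData θ (A t)
  system : ∀ t ∈ U, ∀ j : Fin (n + 2), ∀ a b : Fin 2,
    HasFDerivAt (fun s => A s j a b)
      (∑ i ∈ Finset.univ.erase j,
        ((A t i * A t j - A t j * A t i) a b / (pt t j - pt t i)) • (dpt n j - dpt n i)) t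

/-- The coefficient matrix `∑ A_j / (z - t_j)` of the linear system in `z`. -/
def laxMatrix (t : Fin n → ℂ) (A : Fin (n + 2) → Mat2) (z : ℂ) : Mat2 :=
  ∑ j, (z - pt t j)⁻¹ • A j

/-- The parameters shifted by an integer vector, `θ_j + μ_j`. -/
def shift (θ : Fin (n + 3) → ℂ) (μ : Fin (n + 3) → ℤ) : Fin (n + 3) → ℂ :=
  fun j => θ j + (μ j : ℂ)

/-- The rational matrix function `P(z) / q(z)`. -/
def ratMatrix (P : Matrix (Fin 2) (Fin 2) ℂ[X]) (q : ℂ[X]) (z : ℂ) : Mat2 :=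
  (q.eval z)⁻¹ • P.map (fun p => p.eval z)

/-- `A' = T_μ(A)` at the point `t`, for `μ` in the lattice `L` of integer vectors with even sum:
there is an invertible matrix `R = P / q` of rational functions of `z` such that `Y ↦ R Y` takes
solutions of `Y' = (∑ A_j / (z - t_j)) Y` to solutions of `Y' = (∑ A'_j / (z - t_j)) Y`, i.e.
`R' = (∑ A'_j / (z - t_j)) R - R (∑ A_j / (z - t_j))`, and `A'` satisfies the same algebraic
conditions as `A` with the parameters `θ_j` replaced by `θ_j + μ_j`.
For non-integral `θ_j` such an `A'` is unique up to conjugation by a diagonal matrix,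
which does not change the traces `tr A'_i A'_j`. -/
def IsSchlesingerTransform (θ : Fin (n + 3) → ℂ) (μ : Fin (n + 3) → ℤ) (t : Fin n → ℂ)
    (A A' : Fin (n + 2) → Mat2) : Prop :=
  Even (∑ j, μ j) ∧ IsResidueData (shift θ μ) A' ∧
    ∃ (P : Matrix (Fin 2) (Fin 2) ℂ[X]) (q : ℂ[X]), q ≠ 0 ∧ P.det ≠ 0 ∧
      ∀ z : ℂ, q.eval z ≠ 0 → (∀ j, z ≠ pt t j) → ∀ a b : Fin 2,
        HasDerivAt (fun w => ratMatrix P q w a b)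
          ((laxMatrix t A' z * ratMatrix P q z - ratMatrix P q z * laxMatrix t A z) a b) z

/-- The constants `C_{ij}`. -/
def hamConst (θ : Fin (n + 3) → ℂ) (i j : Fin (n + 2)) : ℂ :=
  -(θ i.castSucc * θ j.castSucc) / 2
    + (θ i.castSucc ^ 2 + θ j.castSucc ^ 2) / (2 * ((n : ℂ) + 1))
    - (∑ k, θ k ^ 2) / (2 * ((n : ℂ) + 1) * ((n : ℂ) + 2))

/-- The Schlesinger Hamiltonian `H_i = ∑_{j ≠ i} (tr A_i A_j + C_{ij}) / (t_i - t_j)`. -/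
def schlesingerHam (θ : Fin (n + 3) → ℂ) (t : Fin n → ℂ) (A : Fin (n + 2) → Mat2)
    (i : Fin n) : ℂ :=
  ∑ j ∈ Finset.univ.erase (mov i),
    ((A (mov i) * A j).trace + hamConst θ (mov i) j) / (pt t (mov i) - pt t j)

/-- `x_i = t_i / (t_i - 1)`. -/
def coordX (t : Fin n → ℂ) : Fin n → ℂ := fun i => t i / (t i - 1)

/-- `b_∞ = ∑ t_j b_j`. -/
def bInf (t : Fin n → ℂ) (A : Fin (n + 2) → Mat2) : ℂ := ∑ j, pt t j * A j 0 1

/-- `q_i = t_i b_i / b_∞`. -/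
def garnierQ (t : Fin n → ℂ) (A : Fin (n + 2) → Mat2) (i : Fin n) : ℂ :=
  t i * A (mov i) 0 1 / bInf t A

/-- `p_i = (b_∞ / t_i) (a_i / b_i + (t_i - 1) a_{n+1} / b_{n+1} - t_i a_{n+2} / b_{n+2})`. -/
def garnierP (t : Fin n → ℂ) (A : Fin (n + 2) → Mat2) (i : Fin n) : ℂ :=
  bInf t A / t i *
    (A (mov i) 0 0 / A (mov i) 0 1
      + (t i - 1) * (A (idxZero n) 0 0 / A (idxZero n) 0 1)
      - t i * (A (idxOne n) 0 0 / A (idxOne n) 0 1))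

/-- The relabelling of the parameters: it sends the index `k` of `θ_k` to the index `j` of the
`ε_j` that comes from `θ_k`, i.e. (1-based) `k ↦ k + 3` for `k ≤ n` and `n+1, n+2, n+3 ↦ 1, 2, 3`. -/
def epsIndex (n : ℕ) : Fin (n + 3) ≃ Fin (n + 3) :=
  finAddFlip.trans (finCongr (Nat.add_comm 3 n))

/-- `ε_1 = θ_{n+1}`, `ε_2 = θ_{n+2}`, `ε_3 = θ_{n+3} + 1`, `ε_j = θ_{j-3}` for `j ≥ 4`. -/
def eps (θ : Fin (n + 3) → ℂ) (j : Fin (n + 3)) : ℂ :=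
  θ ((epsIndex n).symm j) + if j = 2 then 1 else 0

/-- The index `i + 3` of `ε_{i+3} = θ_i`, for `i ≤ n`. -/
def epsMov (i : Fin n) : Fin (n + 3) := epsIndex n (mov i).castSucc

/-- The vector `e_{n+3} - e_{n+1}` (in the ordering of the `θ_j`). -/
def garnierBase (n : ℕ) : Fin (n + 3) → ℤ :=
  Pi.single (Fin.last (n + 2)) 1 - Pi.single (idxZero n).castSucc 1

/-- The shift of the `θ_j` that belongs to the Garnier `τ`-function with label `μ`; the label is in
the ordering of the `ε_j`, and label `0` corresponds to `T_{n+3,-(n+1)}`. -/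
def garnierShift (μ : Fin (n + 3) → ℤ) : Fin (n + 3) → ℤ :=
  (fun k => μ (epsIndex n k)) + garnierBase n

/-- `τ`, a function of `x_1, …, x_n`, is a Garnier `τ`-function with label `μ` for the solution `A`
over `U`: it is nowhere zero and `d log τ = ∑ T_μ(H̄_i) dx_i` on the image of `U`, where the
Garnier Hamiltonians `H̄_i` are given by `-(x_i - 1)^2 H̄_i = T_{n+3,-(n+1)}(H_i)`, so that
`-(x_i - 1)^2 T_μ(H̄_i)` is the value of `H_i` at the Schlesinger transform of `A` with
shift `garnierShift μ`. -/
def IsGarnierTau (θ : Fin (n + 3) → ℂ) (U : Set (Fin n → ℂ))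
    (A : (Fin n → ℂ) → Fin (n + 2) → Mat2) (μ : Fin (n + 3) → ℤ)
    (τ : (Fin n → ℂ) → ℂ) : Prop :=
  ∀ t ∈ U, τ (coordX t) ≠ 0 ∧
    ∃ A' : Fin (n + 2) → Mat2, IsSchlesingerTransform θ (garnierShift μ) t (A t) A' ∧
      HasFDerivAt τ
        (∑ i, (τ (coordX t) *
            (-schlesingerHam (shift θ (garnierShift μ)) t A' i / (coordX t i - 1) ^ 2)) •
          (ContinuousLinearMap.proj i : (Fin n → ℂ) →L[ℂ] ℂ)) (coordX t)

/-- The standard basis vector `e_{j+1}` of the lattice (the index `j` is 0-based). -/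
def basisVec (j : Fin (n + 3)) : Fin (n + 3) → ℤ := Pi.single j 1

/-- `(∂/∂x_i) log f = (∂f/∂x_i) / f`. -/
def dlog (i : Fin n) (f : (Fin n → ℂ) → ℂ) (x : Fin n → ℂ) : ℂ :=
  fderiv ℂ f x (Pi.single i 1) / f x

/-- `X̄_i = ∑_{j ≠ i, j ≤ n+2} x_i (x_j - 1) / ((n+1)(n+2)(x_i - x_j))`, where `x_{n+1} = 0` and
`x_{n+2} = ∞` are the images of `t_{n+1} = 0` and `t_{n+2} = 1` under `t ↦ t / (t - 1)`; the term
`j = n+2` is the limit `- x_i / ((n+1)(n+2))`. -/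
def xBar (x : Fin n → ℂ) (i : Fin n) : ℂ :=
  (∑ j ∈ Finset.univ.erase i, x i * (x j - 1) / (x i - x j)
      + x i * (0 - 1) / (x i - 0) - x i) / (((n : ℂ) + 1) * ((n : ℂ) + 2))

/-- `Γ̄^i_{-k} = - ε_i / 2 + (1 - 2 ε_k) / (2 (n+1))`. -/
def gammaBar (θ : Fin (n + 3) → ℂ) (i k : Fin (n + 3)) : ℂ :=
  -eps θ i / 2 + (1 - 2 * eps θ k) / (2 * ((n : ℂ) + 1))

end Garnier

end

namespace Garnier

/-! The identities are algebraic at each point t. A ratio of two τ-functions has as logarithmic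
derivative a difference of Hamiltonians of two Schlesinger transforms. In the ordering of the θ_j,
the labels (1,3), (1,-3), (1,-2) and 0 become the shifts 2e_{n+3}, 0, e_{n+3} - e_{n+2} and e_{n+3}
- e_{n+1}, so only these few transforms have to be understood.

The gauge matrix is only assumed rational. Since the θ_j are not integers, its local exponents bound
its poles at the t_j (`IsRatGauge.pole`, `exists_isPolyGauge`) and its degree at infinity
(`IsPolyGauge.coeff_top`). Once denominators are cleared it is Q(z) = z S₁ + S₀, where S₁ has at
most its upper left entry nonzero.

Expanding the gauge equation at t_i shows that the trace part of H_i changes by tr(A_i Q(t_i)⁻¹ S₁)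
(`IsLinGauge.traceHam_eq`). The residue relations determine the needed ratios of entries of S₁ and
S₀: the shift by 2e_{n+3} produces b_i/b_∞, hence q_i, and the shifts e_{n+3} - e_k produce a_k/b_k,
hence q_i p_i. The changes of the constants C_{ij} account for the terms in X̄_i and Γ̄. -/

variable {n : ℕ}

/-! ### Polynomial form of the gauge equation -/

/-- The product `∏_j (z - t_j)` over the finite singular points. -/
noncomputable def nodalPoly (t : Fin n → ℂ) : ℂ[X] := Lagrange.nodal Finset.univ (pt t)

/-- The product `∏_{l ≠ j} (z - t_l)`. -/
noncomputable def conodalPoly (t : Fin n → ℂ) (j : Fin (n + 2)) : ℂ[X] :=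
  Lagrange.nodal (Finset.univ.erase j) (pt t)

/-- The polynomial matrix `∏_j (z - t_j) * ∑_j A_j / (z - t_j)`. -/
noncomputable def laxPoly (t : Fin n → ℂ) (A : Fin (n + 2) → Mat2) :
    Matrix (Fin 2) (Fin 2) ℂ[X] :=
  Matrix.of fun a b => ∑ j, C (A j a b) * conodalPoly t j

/-- The gauge equation `R' = A'(z) R - R A(z)` for `R = P / q`, cleared of denominators. -/
def IsRatGauge (t : Fin n → ℂ) (A A' : Fin (n + 2) → Mat2)
    (P : Matrix (Fin 2) (Fin 2) ℂ[X]) (q : ℂ[X]) : Prop :=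
  ∀ a b, nodalPoly t * (derivative (P a b) * q - P a b * derivative q) =
    q * ((laxPoly t A' * P - P * laxPoly t A) a b)

/-- The gauge equation `Q' = A'(z) Q - Q A(z)` for a polynomial matrix `Q`. -/
def IsPolyGauge (t : Fin n → ℂ) (A A' : Fin (n + 2) → Mat2)
    (Q : Matrix (Fin 2) (Fin 2) ℂ[X]) : Prop :=
  ∀ a b, nodalPoly t * derivative (Q a b) = (laxPoly t A' * Q - Q * laxPoly t A) a b

lemma nodalPoly_eq_mul_conodalPoly (t : Fin n → ℂ) (j : Fin (n + 2)) :
    nodalPoly t = (X - C (pt t j)) * conodalPoly t j :=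
  Lagrange.nodal_eq_mul_nodal_erase (Finset.mem_univ j)

lemma nodalPoly_ne_zero (t : Fin n → ℂ) : nodalPoly t ≠ 0 := Lagrange.nodal_ne_zero

lemma eval_nodalPoly_ne_zero {t : Fin n → ℂ} {z : ℂ} (hz : ∀ j, z ≠ pt t j) :
    (nodalPoly t).eval z ≠ 0 :=
  Lagrange.eval_nodal_not_at_node fun j _ => hz j

lemma eval_conodalPoly_self_ne_zero {t : Fin n → ℂ} (ht : Function.Injective (pt t))
    (j : Fin (n + 2)) : (conodalPoly t j).eval (pt t j) ≠ 0 :=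
  Lagrange.eval_nodal_not_at_node fun _ hl h => (Finset.mem_erase.1 hl).1 (ht h).symm

lemma eval_conodalPoly_of_ne {t : Fin n → ℂ} {i j : Fin (n + 2)} (h : i ≠ j) :
    (conodalPoly t i).eval (pt t j) = 0 :=
  Lagrange.eval_nodal_at_node (Finset.mem_erase.2 ⟨h.symm, Finset.mem_univ j⟩)

lemma eval_laxPoly {t : Fin n → ℂ} (A : Fin (n + 2) → Mat2) {z : ℂ} (hz : ∀ j, z ≠ pt t j)
    (a b : Fin 2) :
    (laxPoly t A a b).eval z = (nodalPoly t).eval z * laxMatrix t A z a b := by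
  simp only [laxPoly, laxMatrix, Matrix.of_apply, eval_finsetSum, eval_mul, eval_C,
    Matrix.sum_apply, Matrix.smul_apply, smul_eq_mul, Finset.mul_sum]
  refine Finset.sum_congr rfl fun j _ => ?_
  have hj : z - pt t j ≠ 0 := sub_ne_zero.2 (hz j)
  rw [nodalPoly_eq_mul_conodalPoly t j]
  simp only [eval_mul, eval_sub, eval_X, eval_C]
  field_simp

lemma eval_laxPoly_pt (t : Fin n → ℂ) (A : Fin (n + 2) → Mat2) (j : Fin (n + 2))
    (a b : Fin 2) :
    (laxPoly t A a b).eval (pt t j) = (conodalPoly t j).eval (pt t j) * A j a b := by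
  simp only [laxPoly, Matrix.of_apply, eval_finsetSum, eval_mul, eval_C]
  rw [Finset.sum_eq_single j (fun i _ hi => by rw [eval_conodalPoly_of_ne hi, mul_zero])
    (fun h => absurd (Finset.mem_univ j) h), mul_comm]

lemma eq_of_eval_eq_off_roots {p r s : ℂ[X]} (hs : s ≠ 0)
    (h : ∀ z, s.eval z ≠ 0 → p.eval z = r.eval z) : p = r := by
  have h0 : s * (p - r) = 0 := by
    refine Polynomial.funext fun z => ?_
    by_cases hz : s.eval z = 0
    · simp [hz]
    · simp [h z hz]
  exact sub_eq_zero.1 ((mul_eq_zero.1 h0).resolve_left hs)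

lemma isRatGauge_of_hasDerivAt {t : Fin n → ℂ} {A A' : Fin (n + 2) → Mat2}
    {P : Matrix (Fin 2) (Fin 2) ℂ[X]} {q : ℂ[X]} (hq : q ≠ 0)
    (h : ∀ z : ℂ, q.eval z ≠ 0 → (∀ j, z ≠ pt t j) → ∀ a b : Fin 2,
        HasDerivAt (fun w => ratMatrix P q w a b)
          ((laxMatrix t A' z * ratMatrix P q z - ratMatrix P q z * laxMatrix t A z) a b) z) :
    IsRatGauge t A A' P q := by
  intro a b
  refine eq_of_eval_eq_off_roots (mul_ne_zero hq (nodalPoly_ne_zero t)) fun z hz => ?_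
  rw [eval_mul] at hz
  obtain ⟨hqz, hDz⟩ := mul_ne_zero_iff.1 hz
  have hzj : ∀ j, z ≠ pt t j := by
    rintro j rfl
    exact hDz (Lagrange.eval_nodal_at_node (Finset.mem_univ j))
  have h1 := h z hqz hzj a b
  have h2 : HasDerivAt (fun w => ratMatrix P q w a b)
      (-(derivative q).eval z / (q.eval z) ^ 2 * (P a b).eval z
        + (q.eval z)⁻¹ * (derivative (P a b)).eval z) z := by
    have := ((q.hasDerivAt z).inv hqz).mul ((P a b).hasDerivAt z)
    exact this
  have h3 := h2.unique h1
  simp only [ratMatrix, Matrix.sub_apply, Matrix.mul_apply, Fin.sum_univ_two, Matrix.smul_apply,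
    Matrix.map_apply, smul_eq_mul] at h3
  simp only [eval_mul, eval_sub, eval_add, Matrix.sub_apply, Matrix.mul_apply, Fin.sum_univ_two,
    eval_laxPoly _ hzj]
  field_simp at h3
  linear_combination (eval z (nodalPoly t)) * h3

/-- The cleared equation is homogeneous of degree two in (P, q): the terms containing h' cancel, so
only a factor h² remains. -/
lemma IsRatGauge.of_smul {t : Fin n → ℂ} {A A' : Fin (n + 2) → Mat2}
    {P : Matrix (Fin 2) (Fin 2) ℂ[X]} {q h : ℂ[X]} (hh : h ≠ 0)
    (hg : IsRatGauge t A A' (h • P) (h * q)) : IsRatGauge t A A' P q := by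
  intro a b
  have := hg a b
  simp only [Matrix.smul_apply, smul_eq_mul, derivative_mul, Matrix.sub_apply, Matrix.mul_apply,
    Fin.sum_univ_two] at this ⊢
  refine mul_left_cancel₀ (pow_ne_zero 2 hh) ?_
  linear_combination this

lemma IsRatGauge.smul {t : Fin n → ℂ} {A A' : Fin (n + 2) → Mat2}
    {P : Matrix (Fin 2) (Fin 2) ℂ[X]} {q : ℂ[X]} (hg : IsRatGauge t A A' P q) (h : ℂ[X]) :
    IsRatGauge t A A' (h • P) (h * q) := by
  intro a b
  have := hg a b
  simp only [Matrix.smul_apply, smul_eq_mul, derivative_mul, Matrix.sub_apply, Matrix.mul_apply,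
    Fin.sum_univ_two] at this ⊢
  linear_combination h ^ 2 * this

/-- A rational gauge matrix can be written without common zeros of numerator and denominator. -/
lemma IsRatGauge.exists_coprime {t : Fin n → ℂ} {A A' : Fin (n + 2) → Mat2}
    {P : Matrix (Fin 2) (Fin 2) ℂ[X]} {q : ℂ[X]} (hq : q ≠ 0) (hP : P.det ≠ 0)
    (hg : IsRatGauge t A A' P q) :
    ∃ (P₁ : Matrix (Fin 2) (Fin 2) ℂ[X]) (q₁ : ℂ[X]), q₁ ≠ 0 ∧ P₁.det ≠ 0 ∧
      IsRatGauge t A A' P₁ q₁ ∧ ∀ c, q₁.eval c = 0 → ∃ a b, (P₁ a b).eval c ≠ 0 := by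
  induction hd : q.natDegree using Nat.strong_induction_on generalizing P q with
  | _ d ih =>
    by_cases hc : ∀ c, q.eval c = 0 → ∃ a b, (P a b).eval c ≠ 0
    · exact ⟨P, q, hq, hP, hg, hc⟩
    push Not at hc
    obtain ⟨c, hqc, hPc⟩ := hc
    obtain ⟨q', rfl⟩ := dvd_iff_isRoot.2 hqc
    choose P' hP' using fun a b => dvd_iff_isRoot.2 (hPc a b)
    obtain rfl : P = (X - C c) • (Matrix.of P') := by
      ext1 a b
      simpa using hP' a b
    rw [Matrix.det_smul] at hP
    have hq' := right_ne_zero_of_mul hq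
    refine ih q'.natDegree ?_ hq' (right_ne_zero_of_mul hP)
      (hg.of_smul (X_sub_C_ne_zero c)) rfl
    rw [← hd, natDegree_mul (X_sub_C_ne_zero c) hq', natDegree_X_sub_C]
    omega

/-! ### Poles of the gauge matrix -/

lemma mul_self_of_det_eq_zero {A : Mat2} (hA : A.det = 0) : A * A = A.trace • A := by
  rw [Matrix.det_fin_two] at hA
  ext a b
  fin_cases a <;> fin_cases b <;>
    simp [Matrix.mul_apply, Fin.sum_univ_two, Matrix.trace_fin_two] <;>
    first | linear_combination -hA | ring1

/-- The eigenvalues of `S ↦ A' S - S A` for singular `A`, `A'`. -/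
lemma eigenvalue_of_intertwiner {A A' S : Mat2} {κ : ℂ} (hA : A.det = 0) (hA' : A'.det = 0)
    (hS : S ≠ 0) (h : A' * S - S * A = κ • S) :
    κ = 0 ∨ κ = -A.trace ∨ κ = A'.trace ∨ κ = A'.trace - A.trace := by
  have hCH := mul_self_of_det_eq_zero hA'
  -- The intertwining relation moves A' across S, so Cayley–Hamilton for A' becomes a quadratic
  -- polynomial in A annihilating S from the right. As S ≠ 0, that polynomial is singular, and its
  -- determinant has the four listed roots.
  have h1 : A' * S = S * (A + κ • 1) := by
    rw [mul_add, mul_smul_comm, mul_one, ← h]; abel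
  have h2 : S * ((A + κ • 1) * (A + (κ - A'.trace) • 1)) = 0 := by
    have : S * ((A + κ • 1) * (A + κ • 1)) = A'.trace • (S * (A + κ • 1)) := by
      rw [← mul_assoc, ← h1, mul_assoc, ← h1, ← mul_assoc, hCH, smul_mul_assoc]
    have h3 : A + (κ - A'.trace) • (1 : Mat2) = (A + κ • 1) - A'.trace • 1 := by
      rw [sub_smul]; abel
    rw [h3, mul_sub, mul_sub, this, mul_smul_comm, mul_one, mul_smul_comm, sub_self]
  have hdet : ((A + κ • 1) * (A + (κ - A'.trace) • (1 : Mat2))).det = 0 := by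
    by_contra hne
    apply hS
    have hu : IsUnit ((A + κ • 1) * (A + (κ - A'.trace) • (1 : Mat2))).det := isUnit_iff_ne_zero.2 hne
    calc S = S * ((A + κ • 1) * (A + (κ - A'.trace) • 1)) *
            ((A + κ • 1) * (A + (κ - A'.trace) • 1))⁻¹ := by
          rw [mul_assoc, Matrix.mul_nonsing_inv _ hu, mul_one]
      _ = 0 := by rw [h2, zero_mul]
  have hval : ∀ x : ℂ, (A + x • (1 : Mat2)).det = x * (x + A.trace) := by
    intro x
    rw [Matrix.det_fin_two] at hA ⊢
    simp [Matrix.trace_fin_two]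
    linear_combination hA
  rw [Matrix.det_mul, hval, hval] at hdet
  rcases mul_eq_zero.1 hdet with h | h <;> rcases mul_eq_zero.1 h with h | h
  · exact .inl h
  · exact .inr (.inl (by linear_combination h))
  · exact .inr (.inr (.inl (by linear_combination h)))
  · exact .inr (.inr (.inr (by linear_combination h)))

/-- A pole of the gauge matrix lies at a singular point, and its order is an eigenvalue of the
intertwining operator there. -/
lemma IsRatGauge.pole {t : Fin n → ℂ} (ht : Function.Injective (pt t))
    {A A' : Fin (n + 2) → Mat2} {P : Matrix (Fin 2) (Fin 2) ℂ[X]} {q : ℂ[X]} (hq : q ≠ 0)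
    (hg : IsRatGauge t A A' P q) {c : ℂ} (hc : q.eval c = 0)
    (hP : ∃ a b, (P a b).eval c ≠ 0) :
    ∃ j, c = pt t j ∧ A' j * P.map (eval c) - P.map (eval c) * A j =
      (-(q.rootMultiplicity c : ℂ)) • P.map (eval c) := by
  obtain ⟨q₁, hq₁, hnd⟩ := exists_eq_pow_rootMultiplicity_mul_and_not_dvd q hq c
  have hpos : 0 < q.rootMultiplicity c := (rootMultiplicity_pos hq).2 hc
  obtain ⟨l, hl⟩ : ∃ l, q.rootMultiplicity c = l + 1 := ⟨_, (Nat.succ_pred_eq_of_pos hpos).symm⟩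
  rw [hl] at hq₁ ⊢
  have hq₁c : q₁.eval c ≠ 0 := fun h => hnd (dvd_iff_isRoot.2 h)
  -- With q = (z - c)^(l+1) q₁, both sides are divisible by (z - c)^l. At z = c only the term with
  -- the factor l + 1 survives, which forces c to be a singular point; one more factor z - t_j can
  -- then be cancelled to read off the residue.
  have key : ∀ a b, nodalPoly t * ((X - C c) * (derivative (P a b) * q₁ - P a b * derivative q₁)
      - ((l : ℂ[X]) + 1) * (P a b * q₁)) =
      (X - C c) * (q₁ * ((laxPoly t A' * P - P * laxPoly t A) a b)) := by
    intro a b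
    have := hg a b
    refine mul_left_cancel₀ (pow_ne_zero l (X_sub_C_ne_zero c)) ?_
    rw [hq₁] at this
    simp only [derivative_mul, derivative_pow, derivative_sub, derivative_X, derivative_C,
      Nat.add_sub_cancel, sub_zero, mul_one, Nat.cast_add, Nat.cast_one, map_add, map_natCast,
      map_one] at this
    linear_combination this
  have hl1 : (l : ℂ) + 1 ≠ 0 := by exact_mod_cast Nat.succ_ne_zero l
  obtain ⟨a₀, b₀, hab⟩ := hP
  have hD : (nodalPoly t).eval c = 0 := by
    have := congrArg (eval c) (key a₀ b₀)
    simp only [eval_mul, eval_sub, eval_add, eval_X, eval_C, sub_self, zero_mul, zero_sub,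
      eval_natCast, eval_one] at this
    simpa [hl1, hab, hq₁c] using this
  obtain ⟨j, rfl⟩ : ∃ j, c = pt t j := by
    by_contra! hne
    exact eval_nodalPoly_ne_zero hne hD
  refine ⟨j, rfl, ?_⟩
  have hE := eval_conodalPoly_self_ne_zero ht j
  ext a b
  have h1 := key a b
  rw [nodalPoly_eq_mul_conodalPoly t j, mul_assoc] at h1
  have h2 := congrArg (eval (pt t j)) (mul_left_cancel₀ (X_sub_C_ne_zero _) h1)
  simp only [eval_mul, eval_sub, eval_add, eval_X, eval_C, sub_self, zero_mul, zero_sub,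
    eval_natCast, eval_one, Matrix.sub_apply, Matrix.mul_apply, Fin.sum_univ_two,
    eval_laxPoly_pt] at h2
  simp only [Matrix.sub_apply, Matrix.mul_apply, Fin.sum_univ_two, Matrix.map_apply,
    Matrix.smul_apply, smul_eq_mul, Nat.cast_add, Nat.cast_one]
  refine mul_left_cancel₀ (mul_ne_zero hE hq₁c) ?_
  linear_combination -h2

/-- The denominator of a gauge matrix between residue data divides `∏_j (z - t_j) ^ m_j` as soon as
`-μ_j ≤ m_j`; clearing it shifts the residues of the target by the scalars `m_j`. -/
theorem exists_isPolyGauge {θ : Fin (n + 3) → ℂ}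
    (hθ : ∀ (j : Fin (n + 3)) (m : ℤ), θ j ≠ (m : ℂ)) {μ : Fin (n + 3) → ℤ} {t : Fin n → ℂ}
    (ht : Function.Injective (pt t)) {A A' : Fin (n + 2) → Mat2} (hA : IsResidueData θ A)
    (hT : IsSchlesingerTransform θ μ t A A') (m : Fin (n + 2) → ℕ)
    (hm : ∀ j, -μ j.castSucc ≤ m j) :
    ∃ Q : Matrix (Fin 2) (Fin 2) ℂ[X], Q.det ≠ 0 ∧
      IsPolyGauge t A (fun j => A' j + (m j : ℂ) • 1) Q := by
  obtain ⟨-, hA', P₀, q₀, hq₀, hP₀, hder⟩ := hT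
  obtain ⟨P, q, hq, hP, hg, hcop⟩ :=
    (isRatGauge_of_hasDerivAt hq₀ hder).exists_coprime hq₀ hP₀
  have hmult : ∀ c, q.eval c = 0 → ∃ j, c = pt t j ∧ q.rootMultiplicity c ≤ m j := by
    intro c hc
    obtain ⟨a₀, b₀, hab⟩ := hcop c hc
    obtain ⟨j, rfl, hj⟩ := hg.pole ht hq hc (hcop c hc)
    refine ⟨j, rfl, ?_⟩
    have hS : P.map (eval (pt t j)) ≠ 0 := fun h => hab (congrFun (congrFun h a₀) b₀)
    have hpos : 0 < q.rootMultiplicity (pt t j) := (rootMultiplicity_pos hq).2 hc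
    have hmj := hm j
    have h1 := eigenvalue_of_intertwiner (hA.det_eq j) (hA'.det_eq j) hS hj
    rw [hA.trace_eq, hA'.trace_eq, shift] at h1
    generalize q.rootMultiplicity (pt t j) = l at *
    -- The eigenvalue is minus the pole order. The value 0 contradicts the presence of a pole, -θ_j
    -- and θ_j + μ_j are not integers, so the order is -μ_j.
    rcases h1 with h | h | h | h
    · have : l = 0 := by exact_mod_cast neg_eq_zero.1 h
      omega
    · exact absurd (by push_cast; linear_combination h) (hθ j.castSucc l)
    · exact absurd (by push_cast; linear_combination -h) (hθ j.castSucc (-l - μ j.castSucc))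
    · have : (-(l : ℤ)) = μ j.castSucc := by
        have : (-(l : ℂ)) = μ j.castSucc := by linear_combination h
        exact_mod_cast this
      omega
  set w : ℂ[X] := ∏ j, (X - C (pt t j)) ^ m j with hw
  have hw0 : w ≠ 0 := Finset.prod_ne_zero_iff.2 fun j _ => pow_ne_zero _ (X_sub_C_ne_zero _)
  have hdvd : q ∣ w := by
    rw [IsAlgClosed.dvd_iff_roots_le_roots hq hw0, Multiset.le_iff_count]
    intro c
    rw [count_roots, count_roots]
    by_cases hc : q.eval c = 0
    · obtain ⟨j, rfl, hj⟩ := hmult c hc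
      refine hj.trans ((le_rootMultiplicity_iff hw0).2 ?_)
      exact Finset.dvd_prod_of_mem _ (Finset.mem_univ j)
    · rw [rootMultiplicity_eq_zero hc]
      exact Nat.zero_le _
  obtain ⟨h, hh⟩ := hdvd
  have hh0 : h ≠ 0 := by
    rintro rfl
    exact hw0 (by rw [hh, mul_zero])
  have hg' := hg.smul h
  rw [mul_comm h q, ← hh] at hg'
  -- The logarithmic derivative of w is ∑ m_j/(z - t_j): multiplying the gauge matrix by w adds m_j
  -- to the j-th target residue.
  have hdw : nodalPoly t * derivative w = w * ∑ j, (m j : ℂ[X]) * conodalPoly t j := by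
    rw [hw, derivative_prod_finset, Finset.mul_sum, Finset.mul_sum]
    refine Finset.sum_congr rfl fun j _ => ?_
    rw [← Finset.mul_prod_erase _ _ (Finset.mem_univ j), nodalPoly_eq_mul_conodalPoly t j]
    rcases Nat.eq_zero_or_pos (m j) with h0 | h0
    · simp [h0]
    · obtain ⟨l, hl⟩ := Nat.exists_eq_succ_of_ne_zero h0.ne'
      rw [hl]
      simp only [derivative_pow, derivative_sub, derivative_X, derivative_C, sub_zero, mul_one,
        Nat.succ_sub_one, Nat.succ_eq_add_one, map_natCast]
      ring
  refine ⟨h • P, ?_, fun a b => ?_⟩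
  · rw [Matrix.det_smul]
    exact mul_ne_zero (pow_ne_zero _ hh0) hP
  have hlax : laxPoly t (fun j => A' j + (m j : ℂ) • 1) =
      laxPoly t A' + (∑ j, (m j : ℂ[X]) * conodalPoly t j) • 1 := by
    ext1 a b
    simp only [laxPoly, Matrix.of_apply, Matrix.add_apply, Matrix.smul_apply, smul_eq_mul,
      map_add, add_mul, Finset.sum_add_distrib, Matrix.one_apply, Finset.sum_mul]
    congr 1
    refine Finset.sum_congr rfl fun j _ => ?_
    split_ifs <;> simp
  have h1 := hg' a b
  rw [hlax, add_mul, smul_mul_assoc, one_mul]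
  refine mul_left_cancel₀ hw0 ?_
  rw [Matrix.sub_apply, Matrix.add_apply, Matrix.smul_apply (_ : ℂ[X]) (h • P), smul_eq_mul]
  rw [Matrix.sub_apply] at h1
  linear_combination h1 + (h • P) a b * hdw

/-! ### Degree of the gauge matrix at infinity -/

lemma natDegree_nodalPoly (t : Fin n → ℂ) : (nodalPoly t).natDegree = n + 2 := by
  simp [nodalPoly, Lagrange.natDegree_nodal]

lemma natDegree_conodalPoly (t : Fin n → ℂ) (j : Fin (n + 2)) :
    (conodalPoly t j).natDegree = n + 1 := by
  simp [conodalPoly, Lagrange.natDegree_nodal]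

lemma natDegree_laxPoly_le (t : Fin n → ℂ) (A : Fin (n + 2) → Mat2) (a b : Fin 2) :
    (laxPoly t A a b).natDegree ≤ n + 1 := by
  rw [laxPoly, Matrix.of_apply]
  refine natDegree_sum_le_of_forall_le _ _ fun j _ => ?_
  exact (natDegree_C_mul_le _ _).trans (natDegree_conodalPoly t j).le

lemma coeff_laxPoly (t : Fin n → ℂ) (A : Fin (n + 2) → Mat2) (a b : Fin 2) :
    (laxPoly t A a b).coeff (n + 1) = (∑ j, A j) a b := by
  simp only [laxPoly, Matrix.of_apply, finsetSum_coeff, coeff_C_mul, Matrix.sum_apply]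
  refine Finset.sum_congr rfl fun j _ => ?_
  have : (conodalPoly t j).coeff (n + 1) = 1 := by
    rw [← natDegree_conodalPoly t j]
    exact (Lagrange.nodal_monic : (conodalPoly t j).Monic)
  rw [this, mul_one]

/-- The leading coefficient of a polynomial gauge matrix at `z = ∞`. -/
lemma IsPolyGauge.coeff_top {t : Fin n → ℂ} {A A' : Fin (n + 2) → Mat2}
    {Q : Matrix (Fin 2) (Fin 2) ℂ[X]} (hg : IsPolyGauge t A A' Q) {α α' : Fin 2 → ℂ}
    (hα : -∑ j, A j = Matrix.diagonal α) (hα' : -∑ j, A' j = Matrix.diagonal α') {N : ℕ}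
    (hN : ∀ a b, (Q a b).natDegree ≤ N) (a b : Fin 2) :
    ((N : ℂ) - (α b - α' a)) * (Q a b).coeff N = 0 := by
  -- Multiplying by X first makes the coefficient of z^N in zQ' equal to N times that of Q, also for
  -- N = 0.
  have h := congrArg (fun p => (X * p).coeff (n + 1 + N + 1)) (hg a b)
  have hL : (X * (nodalPoly t * derivative (Q a b))).coeff (n + 1 + N + 1) =
      N * (Q a b).coeff N := by
    have hx : (X * derivative (Q a b)).coeff N = N * (Q a b).coeff N := by
      cases N with
      | zero => simp
      | succ N =>
        rw [coeff_X_mul, coeff_derivative]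
        push_cast
        ring
    have hd : (X * derivative (Q a b)).natDegree ≤ N := by
      by_cases h0 : (Q a b).natDegree = 0
      · rw [natDegree_eq_zero.1 h0 |>.choose_spec.symm]
        simp
      · have h1 := natDegree_derivative_lt h0
        have h2 : (X * derivative (Q a b)).natDegree ≤ 1 + (derivative (Q a b)).natDegree :=
          natDegree_mul_le_of_le natDegree_X_le le_rfl
        have := hN a b
        omega
    have h1 : (nodalPoly t).coeff (n + 2) = 1 := by
      rw [← natDegree_nodalPoly t]
      exact (Lagrange.nodal_monic : (nodalPoly t).Monic)
    rw [mul_left_comm, show n + 1 + N + 1 = n + 2 + N by ring,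
      coeff_mul_add_eq_of_natDegree_le (natDegree_nodalPoly t).le hd, hx, h1, one_mul]
  have e1 : ∀ c, (laxPoly t A' a c * Q c b).coeff (n + 1 + N) =
      (-Matrix.diagonal α') a c * (Q c b).coeff N := fun c => by
    rw [coeff_mul_add_eq_of_natDegree_le (natDegree_laxPoly_le t A' a c) (hN c b),
      coeff_laxPoly, ← hα', neg_neg]
  have e2 : ∀ c, (Q a c * laxPoly t A c b).coeff (n + 1 + N) =
      (Q a c).coeff N * (-Matrix.diagonal α) c b := fun c => by
    rw [mul_comm, coeff_mul_add_eq_of_natDegree_le (natDegree_laxPoly_le t A c b) (hN a c),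
      coeff_laxPoly, ← hα, neg_neg, mul_comm]
  simp only [hL] at h
  rw [coeff_X_mul, Matrix.sub_apply, Matrix.mul_apply, Matrix.mul_apply, coeff_sub,
    Fin.sum_univ_two, Fin.sum_univ_two, coeff_add, coeff_add, e1, e1, e2, e2] at h
  fin_cases a <;> fin_cases b <;> simp [-mul_eq_zero] at h ⊢ <;>
    linear_combination h

/-- Apply `IsPolyGauge.coeff_top` to an entry of maximal degree: if that degree were at least 2, its
leading coefficient would vanish. -/
lemma IsPolyGauge.natDegree_le_one {t : Fin n → ℂ} {A A' : Fin (n + 2) → Mat2}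
    {Q : Matrix (Fin 2) (Fin 2) ℂ[X]} (hg : IsPolyGauge t A A' Q) {α α' : Fin 2 → ℂ}
    (hα : -∑ j, A j = Matrix.diagonal α) (hα' : -∑ j, A' j = Matrix.diagonal α')
    (hαα' : ∀ (N : ℕ) (a b : Fin 2), 2 ≤ N → (N : ℂ) ≠ α b - α' a) (a b : Fin 2) :
    (Q a b).natDegree ≤ 1 := by
  obtain ⟨⟨a₀, b₀⟩, -, hmax⟩ := Finset.exists_max_image (Finset.univ : Finset (Fin 2 × Fin 2))
    (fun p => (Q p.1 p.2).natDegree) Finset.univ_nonempty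
  have hN : ∀ a b, (Q a b).natDegree ≤ (Q a₀ b₀).natDegree :=
    fun a b => hmax (a, b) (Finset.mem_univ _)
  refine (hN a b).trans ?_
  by_contra! hlt
  have h1 := hg.coeff_top hα hα' hN a₀ b₀
  have h2 : Q a₀ b₀ = 0 := leadingCoeff_eq_zero.1
    ((mul_eq_zero.1 h1).resolve_left (sub_ne_zero.2 (hαα' _ _ _ hlt)))
  rw [h2] at hlt
  simp at hlt

/-- The gauge equation for `Q = z S₁ + S₀`. -/
def IsLinGauge (t : Fin n → ℂ) (A A' : Fin (n + 2) → Mat2) (S₁ S₀ : Mat2) : Prop :=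
  ∀ z, (∀ j, z ≠ pt t j) →
    S₁ = laxMatrix t A' z * (z • S₁ + S₀) - (z • S₁ + S₀) * laxMatrix t A z

/-- A polynomial gauge matrix is linear in `z` when the exponents at infinity force this. -/
theorem IsPolyGauge.exists_isLinGauge {t : Fin n → ℂ} {A A' : Fin (n + 2) → Mat2}
    {Q : Matrix (Fin 2) (Fin 2) ℂ[X]} (hg : IsPolyGauge t A A' Q) (hQ : Q.det ≠ 0)
    {α α' : Fin 2 → ℂ}
    (hα : -∑ j, A j = Matrix.diagonal α) (hα' : -∑ j, A' j = Matrix.diagonal α')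
    (hαα' : ∀ (N : ℕ) (a b : Fin 2), 2 ≤ N → (N : ℂ) ≠ α b - α' a) :
    ∃ S₁ S₀ : Mat2, IsLinGauge t A A' S₁ S₀ ∧ (∃ z : ℂ, (z • S₁ + S₀).det ≠ 0) ∧
      ∀ a b, 1 ≠ α b - α' a → S₁ a b = 0 := by
  have hd := hg.natDegree_le_one hα hα' hαα'
  have hQe : ∀ a b, Q a b = C ((Q a b).coeff 1) * X + C ((Q a b).coeff 0) :=
    fun a b => eq_X_add_C_of_natDegree_le_one (hd a b)
  have hev : ∀ z a b, (Q a b).eval z = z * (Q a b).coeff 1 + (Q a b).coeff 0 := fun z a b => by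
    conv_lhs => rw [hQe a b]
    simp only [eval_add, eval_mul, eval_C, eval_X, mul_comm]
  have hder : ∀ a b, derivative (Q a b) = C ((Q a b).coeff 1) := fun a b => by
    conv_lhs => rw [hQe a b]
    simp only [derivative_add, derivative_mul, derivative_C, derivative_X, zero_mul, mul_one,
      zero_add, add_zero]
  refine ⟨Q.map (coeff · 1), Q.map (coeff · 0), fun z hz => ?_, ?_, fun a b hab => ?_⟩
  · ext a b
    have h := congrArg (eval z) (hg a b)
    simp only [hder, eval_mul, eval_sub, eval_add, eval_C, Matrix.sub_apply, Matrix.mul_apply,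
      Fin.sum_univ_two, eval_laxPoly _ hz, hev] at h
    simp only [Matrix.sub_apply, Matrix.mul_apply, Fin.sum_univ_two, Matrix.add_apply,
      Matrix.smul_apply, smul_eq_mul, Matrix.map_apply]
    refine mul_left_cancel₀ (eval_nodalPoly_ne_zero hz) ?_
    linear_combination h
  · by_contra! h0
    refine hQ (Polynomial.funext fun z => ?_)
    have := h0 z
    rw [Matrix.det_fin_two] at this ⊢
    simp only [Matrix.add_apply, Matrix.smul_apply, smul_eq_mul, Matrix.map_apply] at this
    simp only [eval_sub, eval_mul, hev, eval_zero]
    exact this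
  · have := hg.coeff_top hα hα' hd a b
    exact (mul_eq_zero.1 this).resolve_left (sub_ne_zero.2 (by simpa using hab))

/-! ### Local expansion at a singular point and the change of the Hamiltonians -/

/-- The regular part of the coefficient matrix at the singular point `t_i`. -/
noncomputable def laxRegular (t : Fin n → ℂ) (A : Fin (n + 2) → Mat2) (i : Fin (n + 2)) (z : ℂ) :
    Mat2 :=
  ∑ j ∈ Finset.univ.erase i, (z - pt t j)⁻¹ • A j

lemma laxMatrix_eq_add_laxRegular (t : Fin n → ℂ) (A : Fin (n + 2) → Mat2) (i : Fin (n + 2))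
    (z : ℂ) : laxMatrix t A z = (z - pt t i)⁻¹ • A i + laxRegular t A i z :=
  (Finset.add_sum_erase _ _ (Finset.mem_univ i)).symm

lemma continuousAt_laxRegular {t : Fin n → ℂ} (ht : Function.Injective (pt t))
    (A : Fin (n + 2) → Mat2) (i : Fin (n + 2)) :
    ContinuousAt (laxRegular t A i) (pt t i) := by
  refine tendsto_finsetSum _ fun j hj => ?_
  have hne : pt t i - pt t j ≠ 0 := sub_ne_zero.2 fun h => (Finset.mem_erase.1 hj).1 (ht h).symm
  have h1 : ContinuousAt (fun z : ℂ => z - pt t j) (pt t i) := by fun_prop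
  exact (h1.inv₀ hne).smul continuousAt_const

lemma eventually_ne_pt {t : Fin n → ℂ} (ht : Function.Injective (pt t)) (i : Fin (n + 2)) :
    ∀ᶠ z in nhdsWithin (pt t i) {pt t i}ᶜ, ∀ j, z ≠ pt t j := by
  rw [Filter.eventually_all]
  intro j
  by_cases h : j = i
  · subst h
    exact self_mem_nhdsWithin
  · exact (isOpen_ne.eventually_mem (x := pt t i) (fun h' => h (ht h').symm)).filter_mono
      nhdsWithin_le_nhds

lemma IsLinGauge.expand {t : Fin n → ℂ} {A A' : Fin (n + 2) → Mat2} {S₁ S₀ : Mat2}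
    (hg : IsLinGauge t A A' S₁ S₀) (i : Fin (n + 2)) {z : ℂ} (hz : ∀ j, z ≠ pt t j) :
    A' i * (pt t i • S₁ + S₀) - (pt t i • S₁ + S₀) * A i =
      (z - pt t i) • (S₁ - (A' i * S₁ - S₁ * A i + (laxRegular t A' i z * (z • S₁ + S₀)
        - (z • S₁ + S₀) * laxRegular t A i z))) := by
  have h := hg z hz
  have hzi : z - pt t i ≠ 0 := sub_ne_zero.2 (hz i)
  rw [laxMatrix_eq_add_laxRegular t A' i, laxMatrix_eq_add_laxRegular t A i] at h
  generalize laxRegular t A' i z = L' at *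
  generalize laxRegular t A i z = L at *
  ext a b
  have hab := congrFun (congrFun h a) b
  simp only [Matrix.sub_apply, Matrix.mul_apply, Fin.sum_univ_two, Matrix.add_apply,
    Matrix.smul_apply, smul_eq_mul] at hab ⊢
  field_simp at hab
  linear_combination -hab

/-- These are the coefficients of (z - t_i)⁻¹ and (z - t_i)⁰ in the gauge equation, obtained as
limits z → t_i of `IsLinGauge.expand`, the second after dividing by z - t_i. -/
theorem IsLinGauge.residue {t : Fin n → ℂ} (ht : Function.Injective (pt t))
    {A A' : Fin (n + 2) → Mat2} {S₁ S₀ : Mat2} (hg : IsLinGauge t A A' S₁ S₀)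
    (i : Fin (n + 2)) :
    A' i * (pt t i • S₁ + S₀) = (pt t i • S₁ + S₀) * A i ∧
      S₁ = A' i * S₁ - S₁ * A i + (laxRegular t A' i (pt t i) * (pt t i • S₁ + S₀)
        - (pt t i • S₁ + S₀) * laxRegular t A i (pt t i)) := by
  have hQ : ContinuousAt (fun z : ℂ => z • S₁ + S₀) (pt t i) := by fun_prop
  have hF : ContinuousAt (fun z : ℂ => S₁ - (A' i * S₁ - S₁ * A i +
      (laxRegular t A' i z * (z • S₁ + S₀) - (z • S₁ + S₀) * laxRegular t A i z))) (pt t i) :=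
    continuousAt_const.sub (continuousAt_const.add
      (((continuousAt_laxRegular ht A' i).mul hQ).sub (hQ.mul (continuousAt_laxRegular ht A i))))
  have hs : ContinuousAt (fun z : ℂ => z - pt t i) (pt t i) := by fun_prop
  have h1 : A' i * (pt t i • S₁ + S₀) - (pt t i • S₁ + S₀) * A i = 0 := by
    have hlim := (hs.smul hF).tendsto.mono_left (nhdsWithin_le_nhds (s := {pt t i}ᶜ))
    have hconst := tendsto_const_nhds.congr'
      ((eventually_ne_pt ht i).mono fun z hz => hg.expand i hz)
    have := tendsto_nhds_unique hconst hlim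
    simpa using this
  refine ⟨sub_eq_zero.1 h1, sub_eq_zero.1 ?_⟩
  have hlim := hF.tendsto.mono_left (nhdsWithin_le_nhds (s := {pt t i}ᶜ))
  refine tendsto_nhds_unique hlim (tendsto_const_nhds.congr'
    ((eventually_ne_pt ht i).mono fun z hz => ?_))
  have := hg.expand i hz
  rw [h1] at this
  exact ((smul_eq_zero.1 this.symm).resolve_left (sub_ne_zero.2 (hz i))).symm

/-- Conjugation by Q turns A' into A and L' into L + Q⁻¹S + Q⁻¹SA - AQ⁻¹S. The last two terms cancel
in the trace against A by cyclicity. -/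
lemma trace_mul_eq_of_gauge {A A' L L' Q S : Mat2} (hQ : Q.det ≠ 0) (h₁ : A' * Q = Q * A)
    (h₂ : S = A' * S - S * A + (L' * Q - Q * L)) :
    (A' * L').trace = (A * L).trace + (A * (Q⁻¹ * S)).trace := by
  have hu : IsUnit Q.det := isUnit_iff_ne_zero.2 hQ
  have hr : Q * Q⁻¹ = 1 := Matrix.mul_nonsing_inv _ hu
  have hl : Q⁻¹ * Q = 1 := Matrix.nonsing_inv_mul _ hu
  generalize Q⁻¹ = V at *
  have hA' : A' = Q * A * V := by rw [← h₁, mul_assoc, hr, mul_one]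
  have hconj : V * A' = A * V := by rw [hA', mul_assoc, ← mul_assoc, hl, one_mul]
  have hL' : L' * Q = Q * L + S + S * A - A' * S := by
    linear_combination (norm := abel) -h₂
  calc (A' * L').trace = (A * (V * (L' * Q))).trace := by
        rw [hA', mul_assoc, mul_assoc, Matrix.trace_mul_comm]
        simp only [mul_assoc]
    _ = (A * L + A * (V * S) + (A * (V * S)) * A - A * (A * (V * S))).trace := by
        rw [hL', mul_sub, mul_add, mul_add, ← mul_assoc V A', hconj, ← mul_assoc V Q, hl]
        simp only [mul_sub, mul_add, mul_assoc, one_mul]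
    _ = _ := by
        rw [Matrix.trace_sub, Matrix.trace_add, Matrix.trace_add,
          Matrix.trace_mul_comm (A * (V * S)) A]
        ring

/-- The Hamiltonians without their constant terms. -/
noncomputable def traceHam (t : Fin n → ℂ) (A : Fin (n + 2) → Mat2) (i : Fin (n + 2)) : ℂ :=
  ∑ j ∈ Finset.univ.erase i, (A i * A j).trace / (pt t i - pt t j)

lemma trace_mul_laxRegular (t : Fin n → ℂ) (A : Fin (n + 2) → Mat2) (i : Fin (n + 2)) :
    (A i * laxRegular t A i (pt t i)).trace = traceHam t A i := by
  rw [laxRegular, traceHam, Finset.mul_sum, Matrix.trace_sum]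
  refine Finset.sum_congr rfl fun j _ => ?_
  rw [mul_smul_comm, Matrix.trace_smul, smul_eq_mul, div_eq_inv_mul]

theorem IsLinGauge.traceHam_eq {t : Fin n → ℂ} (ht : Function.Injective (pt t))
    {A A' : Fin (n + 2) → Mat2} {S₁ S₀ : Mat2} (hg : IsLinGauge t A A' S₁ S₀)
    (i : Fin (n + 2)) (hdet : (pt t i • S₁ + S₀).det ≠ 0) :
    traceHam t A' i = traceHam t A i + (A i * ((pt t i • S₁ + S₀)⁻¹ * S₁)).trace := by
  obtain ⟨h₁, h₂⟩ := hg.residue ht i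
  rw [← trace_mul_laxRegular, ← trace_mul_laxRegular]
  exact trace_mul_eq_of_gauge hdet h₁ h₂

/-! ### The particular Schlesinger transformations -/

lemma rho_shift (θ : Fin (n + 3) → ℂ) {μ : Fin (n + 3) → ℤ} {s : ℤ} (hs : ∑ j, μ j = 2 * s) :
    rho (shift θ μ) = rho θ - s := by
  have : (∑ j, (μ j : ℂ)) = 2 * s := by exact_mod_cast hs
  simp only [rho, shift, Finset.sum_add_distrib, this]
  ring

/-- A Schlesinger transformation with small exponents at infinity is given by a gauge matrix
`z S₁ + S₀` after clearing denominators. -/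
theorem IsSchlesingerTransform.exists_isLinGauge {θ : Fin (n + 3) → ℂ}
    (hθ : ∀ (j : Fin (n + 3)) (m : ℤ), θ j ≠ (m : ℂ)) {μ : Fin (n + 3) → ℤ} {t : Fin n → ℂ}
    (ht : Function.Injective (pt t)) {A A' : Fin (n + 2) → Mat2} (hA : IsResidueData θ A)
    (hT : IsSchlesingerTransform θ μ t A A') (m : Fin (n + 2) → ℕ)
    (hm : ∀ j, -μ j.castSucc ≤ m j) {s : ℤ} (hs : ∑ j, μ j = 2 * s) {k : ℤ}
    (hk : ((∑ j, m j : ℕ) : ℤ) = k) (h₀ : s + k ≤ 1) (h₁ : s - μ (Fin.last (n + 2)) + k < 1) :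
    ∃ S₁ S₀ : Mat2, IsLinGauge t A (fun j => A' j + (m j : ℂ) • 1) S₁ S₀ ∧
      (∃ z : ℂ, (z • S₁ + S₀).det ≠ 0) ∧ S₁ 0 1 = 0 ∧ S₁ 1 0 = 0 ∧ S₁ 1 1 = 0 ∧
      (s + k ≠ 1 → S₁ 0 0 = 0) := by
  obtain ⟨Q, hQ, hg⟩ := exists_isPolyGauge hθ ht hA hT m hm
  have hA' := hT.2.1
  have hα' : -∑ j, (A' j + (m j : ℂ) • (1 : Mat2)) =
      Matrix.diagonal ![rho θ - s - k, rho θ - s + θ (Fin.last (n + 2)) + μ (Fin.last (n + 2)) - k] := by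
    have hk' : (∑ j, (m j : ℂ)) = k := by rw [← hk]; push_cast; rfl
    rw [Finset.sum_add_distrib, neg_add, hA'.sum_eq, ← Finset.sum_smul, hk', rho_shift θ hs]
    ext a b
    fin_cases a <;> fin_cases b <;> simp [shift] <;> ring
  have hne : ∀ x : ℤ, θ (Fin.last (n + 2)) ≠ x := hθ _
  -- Off-diagonal exponent differences contain ±θ_{n+3} and so are never integers. By `h₀` and `h₁`
  -- the diagonal ones exclude degree 2 or more, and degree 1 can occur only in the upper left
  -- entry.
  have hval : ∀ (N : ℤ) (a b : Fin 2), (N : ℂ) =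
      ![rho θ, rho θ + θ (Fin.last (n + 2))] b -
        ![rho θ - s - k, rho θ - s + θ (Fin.last (n + 2)) + μ (Fin.last (n + 2)) - k] a →
      (a = 0 ∧ b = 0 ∧ N = s + k) ∨
        (a = 1 ∧ b = 1 ∧ N = s - μ (Fin.last (n + 2)) + k) := by
    intro N a b h
    fin_cases a <;> fin_cases b <;> simp at h ⊢
    · have : (N : ℂ) = s + k := by linear_combination h
      exact_mod_cast this
    · exact hne (N - s - k) (by push_cast; linear_combination -h)
    · exact hne (-N - μ (Fin.last (n + 2)) + s + k) (by push_cast; linear_combination h)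
    · have : (N : ℂ) = s - μ (Fin.last (n + 2)) + k := by linear_combination h
      exact_mod_cast this
  obtain ⟨S₁, S₀, hlin, hdet, hzero⟩ := hg.exists_isLinGauge hQ hA.sum_eq hα' (by
    intro N a b hN h
    rcases hval N a b (by exact_mod_cast h) with ⟨-, -, h⟩ | ⟨-, -, h⟩ <;> omega)
  refine ⟨S₁, S₀, hlin, hdet, hzero 0 1 fun h => ?_, hzero 1 0 fun h => ?_,
    hzero 1 1 fun h => ?_, fun hsk => hzero 0 0 fun h => ?_⟩
  · rcases hval 1 0 1 (by exact_mod_cast h) with ⟨-, h, -⟩ | ⟨h, -, -⟩ <;> simp at h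
  · rcases hval 1 1 0 (by exact_mod_cast h) with ⟨h, -, -⟩ | ⟨-, h, -⟩ <;> simp at h
  · rcases hval 1 1 1 (by exact_mod_cast h) with ⟨h, -, -⟩ | ⟨-, -, h⟩
    · simp at h
    · omega
  · rcases hval 1 0 0 (by exact_mod_cast h) with ⟨-, -, h⟩ | ⟨h, -, -⟩
    · omega
    · simp at h

/-- Here s + k = 0, so S₁ vanishes and the gauge matrix is constant: A' is a simultaneous conjugate
of A. -/
theorem traceHam_of_transform_zero {θ : Fin (n + 3) → ℂ}
    (hθ : ∀ (j : Fin (n + 3)) (m : ℤ), θ j ≠ (m : ℂ)) {t : Fin n → ℂ}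
    (ht : Function.Injective (pt t)) {A A' : Fin (n + 2) → Mat2} (hA : IsResidueData θ A)
    (hT : IsSchlesingerTransform θ 0 t A A') (i : Fin (n + 2)) :
    traceHam t A' i = traceHam t A i := by
  obtain ⟨S₁, S₀, hg, ⟨z, hz⟩, h01, h10, h11, h00⟩ := hT.exists_isLinGauge hθ ht hA 0 (by simp)
    (s := 0) (by simp) (k := 0) (by simp) (by simp) (by simp)
  obtain rfl : S₁ = 0 := by
    ext a b
    fin_cases a <;> fin_cases b
    exacts [h00 (by simp), h01, h10, h11]
  simp only [Pi.zero_apply, Nat.cast_zero, zero_smul, add_zero] at hg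
  have := hg.traceHam_eq ht i (by simpa using hz)
  simpa using this

lemma trace_mul_inv_mul_of_corner (A Q : Mat2) {S : Mat2} (h01 : S 0 1 = 0) (h10 : S 1 0 = 0)
    (h11 : S 1 1 = 0) :
    (A * (Q⁻¹ * S)).trace = S 0 0 * (A 0 0 * Q 1 1 - A 0 1 * Q 1 0) / Q.det := by
  rw [Matrix.inv_def, Matrix.adjugate_fin_two, Matrix.trace_fin_two]
  simp only [Matrix.mul_apply, Fin.sum_univ_two, Matrix.smul_apply, h01, h10, h11,
    Ring.inverse_eq_inv', smul_eq_mul, Matrix.of_apply, Matrix.cons_val_zero, Matrix.cons_val_one]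
  ring

/-- The effect of the shift `θ_{n+3} ↦ θ_{n+3} + 2` on the Hamiltonians. -/
theorem traceHam_of_transform_two {θ : Fin (n + 3) → ℂ}
    (hθ : ∀ (j : Fin (n + 3)) (m : ℤ), θ j ≠ (m : ℂ)) {t : Fin n → ℂ}
    (ht : Function.Injective (pt t)) {A A' : Fin (n + 2) → Mat2} (hA : IsResidueData θ A)
    (hT : IsSchlesingerTransform θ (Pi.single (Fin.last (n + 2)) 2) t A A')
    (hb : bInf t A ≠ 0) (i : Fin (n + 2)) :
    traceHam t A' i =
      traceHam t A i + (θ (Fin.last (n + 2)) + 1) * A i 0 1 / bInf t A := by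
  obtain ⟨S₁, S₀, hg, ⟨z, hz⟩, h01, h10, h11, -⟩ := hT.exists_isLinGauge hθ ht hA 0
    (fun j => by simp [Fin.castSucc_ne_last]) (s := 1) (by simp) (k := 0)
    (by simp) (by simp) (by simp)
  simp only [Pi.zero_apply, Nat.cast_zero, zero_smul, add_zero] at hg
  -- Summing the residue relations brings in only ∑ A_j, which is known, and ∑ t_j A_j, whose upper
  -- right entry is b_∞. The (1,1) entry gives S₀ 1 1 = 0, so det Q is constant; the (0,1) entry
  -- relates S₁ 0 0 to S₀ 0 1.
  have hsum : ∑ j, A' j * (pt t j • S₁ + S₀) = ∑ j, (pt t j • S₁ + S₀) * A j :=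
    Finset.sum_congr rfl fun j _ => (hg.residue ht j).1
  have hM : ∑ j, A' j * (pt t j • S₁ + S₀) = (∑ j, pt t j • A' j) * S₁ + (∑ j, A' j) * S₀ := by
    simp only [mul_add, Finset.sum_add_distrib, Finset.sum_mul, mul_smul_comm, smul_mul_assoc]
  have hM' : ∑ j, (pt t j • S₁ + S₀) * A j = S₁ * (∑ j, pt t j • A j) + S₀ * ∑ j, A j := by
    simp only [add_mul, Finset.sum_add_distrib, Finset.mul_sum, mul_smul_comm, smul_mul_assoc]
  rw [hM, hM', ← neg_neg (∑ j, A' j), ← neg_neg (∑ j, A j), hA.sum_eq, hT.2.1.sum_eq,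
    rho_shift θ (s := 1) (by simp)] at hsum
  have hbM : (∑ j, pt t j • A j) 0 1 = bInf t A := by
    simp [bInf, Matrix.sum_apply]
  have e01 := congrFun (congrFun hsum 0) 1
  have e11 := congrFun (congrFun hsum 1) 1
  simp only [Matrix.add_apply, Matrix.mul_apply, Fin.sum_univ_two, h01, h10, h11, hbM, shift] at e01 e11
  simp at e01 e11
  have hS11 : S₀ 1 1 = 0 := by linear_combination -e11
  have hS01 : S₀ 0 1 * (θ (Fin.last (n + 2)) + 1) = S₁ 0 0 * bInf t A := by
    linear_combination e01
  have hdet : ∀ w : ℂ, (w • S₁ + S₀).det = -(S₀ 0 1 * S₀ 1 0) := by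
    intro w
    rw [Matrix.det_fin_two]
    simp [h01, h10, h11, hS11]
  rw [hdet] at hz
  rw [hg.traceHam_eq ht i (by rwa [hdet]), trace_mul_inv_mul_of_corner _ _ h01 h10 h11, hdet]
  congr 1
  have h1 : S₀ 0 1 ≠ 0 := fun h => hz (by simp [h])
  have h2 : S₀ 1 0 ≠ 0 := fun h => hz (by simp [h])
  simp only [Matrix.add_apply, Matrix.smul_apply, h10, h11, hS11, smul_eq_mul, mul_zero, zero_add]
  field_simp
  linear_combination (-(A i 0 1) * S₀ 1 0) * hS01

/-- Compensates for clearing a simple pole at t_k, which adds the identity to the k-th residue. -/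
lemma traceHam_add_single {t : Fin n → ℂ} (A : Fin (n + 2) → Mat2) {i k : Fin (n + 2)}
    (hik : i ≠ k) :
    traceHam t (fun j => A j + ((Pi.single k 1 : Fin (n + 2) → ℕ) j : ℂ) • 1) i =
      traceHam t A i + (A i).trace / (pt t i - pt t k) := by
  have hk : k ∈ Finset.univ.erase i := Finset.mem_erase.2 ⟨hik.symm, Finset.mem_univ k⟩
  simp only [traceHam]
  rw [← Finset.add_sum_erase _ _ hk, ← Finset.add_sum_erase _ _ hk]
  have : ∀ j ∈ (Finset.univ.erase i).erase k,
      ((A i + ((Pi.single k 1 : Fin (n + 2) → ℕ) i : ℂ) • 1) *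
        (A j + ((Pi.single k 1 : Fin (n + 2) → ℕ) j : ℂ) • 1)).trace / (pt t i - pt t j) =
      (A i * A j).trace / (pt t i - pt t j) := by
    intro j hj
    simp [hik, (Finset.mem_erase.1 hj).1]
  rw [Finset.sum_congr rfl this]
  simp [hik, mul_add]
  ring

/-- The effect of the shift `θ_{n+3} ↦ θ_{n+3} + 1`, `θ_k ↦ θ_k - 1` on the Hamiltonians. -/
theorem traceHam_of_transform_single {θ : Fin (n + 3) → ℂ}
    (hθ : ∀ (j : Fin (n + 3)) (m : ℤ), θ j ≠ (m : ℂ)) {t : Fin n → ℂ}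
    (ht : Function.Injective (pt t)) {A A' : Fin (n + 2) → Mat2} (hA : IsResidueData θ A)
    {i k : Fin (n + 2)} (hik : i ≠ k)
    (hT : IsSchlesingerTransform θ
      (Pi.single (Fin.last (n + 2)) 1 - Pi.single k.castSucc 1) t A A')
    (hb : A k 0 1 ≠ 0) :
    traceHam t A' i = traceHam t A i +
      (A i 0 0 - A k 0 0 / A k 0 1 * A i 0 1 - θ i.castSucc) / (pt t i - pt t k) := by
  have hlast : ∀ j : Fin (n + 2), j.castSucc ≠ Fin.last (n + 2) := Fin.castSucc_ne_last
  obtain ⟨S₁, S₀, hg, ⟨z, hz⟩, h01, h10, h11, -⟩ := hT.exists_isLinGauge hθ ht hA (Pi.single k 1)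
    (fun j => by simp [Pi.single_apply, hlast])
    (s := 0) (by simp) (k := 1) (by simp) (by simp) (by simp [(hlast k).symm])
  have hθk : θ k.castSucc ≠ 0 := by simpa using hθ k.castSucc 0
  have hA' := hT.2.1
  have hres := (hg.residue ht k).1
  simp only [Pi.single_eq_same, Nat.cast_one, one_smul] at hres
  have hdA := hA.det_eq k
  have htA := hA.trace_eq k
  have hdA' := hA'.det_eq k
  have htA' : (A' k).trace = θ k.castSucc - 1 := by
    rw [hA'.trace_eq k]
    simp [shift, hlast, sub_eq_add_neg]
  -- A'_k + 1 has determinant θ_k ≠ 0 while A_k is singular, so the residue relation makes Q(t_k)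
  -- singular. Since S₁ is a corner matrix, det Q is then a multiple of z - t_k.
  have hdetk : (pt t k • S₁ + S₀).det = 0 := by
    have h := congrArg Matrix.det hres
    rw [Matrix.det_mul, Matrix.det_mul, hdA, mul_zero] at h
    refine (mul_eq_zero.1 h).resolve_left ?_
    have : (A' k + 1).det = θ k.castSucc := by
      rw [Matrix.det_fin_two] at hdA' ⊢
      rw [Matrix.trace_fin_two] at htA'
      simp
      linear_combination hdA' + htA'
    rwa [this]
  have hdet : ∀ w : ℂ, (w • S₁ + S₀).det = S₁ 0 0 * S₀ 1 1 * (w - pt t k) := by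
    intro w
    rw [Matrix.det_fin_two] at hdetk ⊢
    simp [h01, h10, h11] at hdetk ⊢
    linear_combination hdetk
  rw [hdet] at hz
  have hr : S₁ 0 0 ≠ 0 := fun h => hz (by simp [h])
  have hs : S₀ 1 1 ≠ 0 := fun h => hz (by simp [h])
  have hrow : S₀ 1 0 * A k 0 1 = S₀ 1 1 * A k 0 0 := by
    have hAA := mul_self_of_det_eq_zero hdA
    have hAA' := mul_self_of_det_eq_zero hdA'
    rw [htA] at hAA
    rw [htA'] at hAA'
    -- The rows of Q(t_k) are left eigenvectors of A_k for θ_k: compare the quadratic relations of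
    -- A_k and A'_k through the intertwining. With a_k + d_k = θ_k, the lower row yields S₀ 1 0 / S₀
    -- 1 1 = a_k / b_k.
    have hQA : (pt t k • S₁ + S₀) * A k = θ k.castSucc • (pt t k • S₁ + S₀) := by
      generalize pt t k • S₁ + S₀ = Q at hres
      have h1 : Q * (A k * A k) = (A' k * A' k + 2 • A' k + 1) * Q := by
        rw [← mul_assoc, ← hres, mul_assoc, ← hres]
        noncomm_ring
      rw [hAA, hAA', mul_smul_comm, ← hres] at h1
      rw [← hres, add_mul, one_mul]
      simp only [add_mul, one_mul, smul_mul_assoc, smul_add] at h1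
      generalize A' k * Q = B at *
      linear_combination (norm := module) -h1
    have h := congrFun (congrFun hQA 1) 1
    simp only [Matrix.mul_apply, Fin.sum_univ_two, Matrix.add_apply, Matrix.smul_apply, h10, h11,
      smul_eq_mul, mul_zero, zero_add] at h
    rw [Matrix.trace_fin_two] at htA
    linear_combination h - S₀ 1 1 * htA
  have hti : pt t i - pt t k ≠ 0 := sub_ne_zero.2 fun h => hik (ht h)
  have hdi : (pt t i • S₁ + S₀).det ≠ 0 := by
    rw [hdet]
    exact mul_ne_zero (mul_ne_zero hr hs) hti
  have hmain := hg.traceHam_eq ht i hdi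
  have hti' : (A' i).trace = θ i.castSucc := by
    rw [hA'.trace_eq i]
    simp [shift, hlast, hik]
  rw [traceHam_add_single A' hik, hti', trace_mul_inv_mul_of_corner _ _ h01 h10 h11,
    hdet] at hmain
  rw [eq_sub_of_add_eq hmain, add_sub_assoc]
  congr 1
  have hg' : A k 0 0 / A k 0 1 = S₀ 1 0 / S₀ 1 1 := by
    rw [div_eq_div_iff hb hs]
    linear_combination -hrow
  rw [hg']
  simp only [Matrix.add_apply, Matrix.smul_apply, h10, h11, smul_eq_mul, mul_zero, zero_add]
  field_simp

/-! ### Relabelling of parameters and shifts -/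

lemma pt_mov (t : Fin n → ℂ) (i : Fin n) : pt t (mov i) = t i := Fin.append_left _ _ _

lemma pt_idxZero (t : Fin n → ℂ) : pt t (idxZero n) = 0 := Fin.append_right _ _ _

lemma pt_idxOne (t : Fin n → ℂ) : pt t (idxOne n) = 1 := Fin.append_right _ _ _

lemma mov_ne_idxZero (i : Fin n) : mov i ≠ idxZero n := by
  simp [mov, idxZero, Fin.ext_iff, i.isLt.ne]

lemma mov_ne_idxOne (i : Fin n) : mov i ≠ idxOne n := by
  have := i.isLt
  simp [mov, idxOne, Fin.ext_iff]
  omega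

lemma epsIndex_idxZero : epsIndex n (idxZero n).castSucc = 0 := by
  have : (idxZero n).castSucc = Fin.natAdd n (0 : Fin 3) := by
    simp [idxZero]
  rw [epsIndex, Equiv.trans_apply, this, finAddFlip_apply_natAdd]
  simp [Fin.ext_iff]

lemma epsIndex_idxOne : epsIndex n (idxOne n).castSucc = 1 := by
  have : (idxOne n).castSucc = Fin.natAdd n (1 : Fin 3) := by
    simp [idxOne]
  rw [epsIndex, Equiv.trans_apply, this, finAddFlip_apply_natAdd]
  simp [Fin.ext_iff]

lemma epsIndex_last : epsIndex n (Fin.last (n + 2)) = 2 := by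
  have : Fin.last (n + 2) = Fin.natAdd n (2 : Fin 3) := by
    simp [Fin.ext_iff]
  rw [epsIndex, Equiv.trans_apply, this, finAddFlip_apply_natAdd]
  simpa [Fin.ext_iff] using (Nat.mod_eq_of_lt (show 2 < n + 3 by omega)).symm

lemma basisVec_comp_epsIndex {j k : Fin (n + 3)} (h : epsIndex n k = j) :
    (fun l => basisVec j (epsIndex n l)) = Pi.single k 1 := by
  subst h
  ext l
  simp [basisVec, Pi.single_apply]

lemma garnierShift_zero : garnierShift (0 : Fin (n + 3) → ℤ) =
    Pi.single (Fin.last (n + 2)) 1 - Pi.single (idxZero n).castSucc 1 := by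
  simp [garnierShift, garnierBase]
  rfl

lemma garnierShift_add : garnierShift (basisVec 0 + basisVec 2 : Fin (n + 3) → ℤ) =
    Pi.single (Fin.last (n + 2)) 2 := by
  have h0 := basisVec_comp_epsIndex (epsIndex_idxZero (n := n))
  have h2 := basisVec_comp_epsIndex (epsIndex_last (n := n))
  ext l
  have h0 := congrFun h0 l
  have h2 := congrFun h2 l
  simp only [garnierShift, garnierBase, Pi.add_apply, Pi.sub_apply, h0, h2]
  simp only [Pi.single_apply]
  split_ifs <;> simp

lemma garnierShift_sub_two : garnierShift (basisVec 0 - basisVec 2 : Fin (n + 3) → ℤ) = 0 := by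
  have h0 := basisVec_comp_epsIndex (epsIndex_idxZero (n := n))
  have h2 := basisVec_comp_epsIndex (epsIndex_last (n := n))
  ext l
  have h0 := congrFun h0 l
  have h2 := congrFun h2 l
  simp only [garnierShift, garnierBase, Pi.add_apply, Pi.sub_apply, h0, h2, Pi.zero_apply]
  ring

lemma garnierShift_sub_one : garnierShift (basisVec 0 - basisVec 1 : Fin (n + 3) → ℤ) =
    Pi.single (Fin.last (n + 2)) 1 - Pi.single (idxOne n).castSucc 1 := by
  have h0 := basisVec_comp_epsIndex (epsIndex_idxZero (n := n))
  have h1 := basisVec_comp_epsIndex (epsIndex_idxOne (n := n))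
  ext l
  have h0 := congrFun h0 l
  have h1 := congrFun h1 l
  simp only [garnierShift, garnierBase, Pi.add_apply, Pi.sub_apply, h0, h1]
  ring

lemma eps_zero (θ : Fin (n + 3) → ℂ) : eps θ 0 = θ (idxZero n).castSucc := by
  rw [eps, ← epsIndex_idxZero, Equiv.symm_apply_apply, if_neg, add_zero]
  rw [← epsIndex_last, (epsIndex n).injective.eq_iff]
  exact Fin.castSucc_ne_last _

lemma eps_one (θ : Fin (n + 3) → ℂ) : eps θ 1 = θ (idxOne n).castSucc := by
  rw [eps, ← epsIndex_idxOne, Equiv.symm_apply_apply, if_neg, add_zero]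
  rw [← epsIndex_last, (epsIndex n).injective.eq_iff]
  exact Fin.castSucc_ne_last _

lemma eps_two (θ : Fin (n + 3) → ℂ) : eps θ 2 = θ (Fin.last (n + 2)) + 1 := by
  rw [eps, if_pos rfl, ← epsIndex_last, Equiv.symm_apply_apply]

lemma eps_epsMov (θ : Fin (n + 3) → ℂ) (i : Fin n) :
    eps θ (epsMov i) = θ (mov i).castSucc := by
  rw [eps, epsMov, Equiv.symm_apply_apply, if_neg, add_zero]
  rw [← epsIndex_last, (epsIndex n).injective.eq_iff]
  exact Fin.castSucc_ne_last _

lemma dlog_div {f g : (Fin n → ℂ) → ℂ} {x : Fin n → ℂ} {u v : Fin n → ℂ}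
    (hf0 : f x ≠ 0) (hg0 : g x ≠ 0)
    (hf : HasFDerivAt f
      (∑ k, (f x * u k) • (ContinuousLinearMap.proj k : (Fin n → ℂ) →L[ℂ] ℂ)) x)
    (hg : HasFDerivAt g
      (∑ k, (g x * v k) • (ContinuousLinearMap.proj k : (Fin n → ℂ) →L[ℂ] ℂ)) x) (i : Fin n) :
    dlog i (fun y => f y / g y) x = u i - v i := by
  have h := hf.mul ((hasDerivAt_inv hg0).comp_hasFDerivAt x hg)
  have h' : HasFDerivAt (fun y => f y / g y) _ x := h
  rw [dlog, h'.fderiv]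
  simp [Pi.single_apply]
  field_simp
  ring

/-! ### The constant terms of the Hamiltonians -/

/-- `∑_{j ≠ i} 1 / (t_i - t_j)` over the finite singular points. -/
noncomputable def recipSum (t : Fin n → ℂ) (i : Fin n) : ℂ :=
  ∑ j ∈ Finset.univ.erase (mov i), (pt t (mov i) - pt t j)⁻¹

lemma schlesingerHam_eq (θ : Fin (n + 3) → ℂ) (t : Fin n → ℂ) (A : Fin (n + 2) → Mat2)
    (i : Fin n) :
    schlesingerHam θ t A i = traceHam t A (mov i) +
      ∑ j ∈ Finset.univ.erase (mov i), hamConst θ (mov i) j / (pt t (mov i) - pt t j) := by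
  rw [schlesingerHam, traceHam, ← Finset.sum_add_distrib]
  exact Finset.sum_congr rfl fun j _ => add_div _ _ _

/-- Under x = t/(t - 1), each summand x_i(x_j - 1)/(x_i - x_j) becomes -t_i/(t_i - t_j). The points
0 and 1 supply the two extra terms. -/
lemma xBar_coordX {t : Fin n → ℂ} (ht : Function.Injective (pt t)) (i : Fin n) :
    xBar (coordX t) i = -(t i * recipSum t i) / (((n : ℂ) + 1) * ((n : ℂ) + 2)) := by
  have h0 : ∀ j, t j ≠ 0 := fun j h => mov_ne_idxZero j (ht (by rw [pt_mov, pt_idxZero, h]))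
  have h1 : ∀ j, t j - 1 ≠ 0 := fun j h =>
    mov_ne_idxOne j (ht (by rw [pt_mov, pt_idxOne, sub_eq_zero.1 h]))
  have hsum : recipSum t i =
      ∑ j ∈ Finset.univ.erase i, (t i - t j)⁻¹ + (t i)⁻¹ + (t i - 1)⁻¹ := by
    rw [recipSum, Finset.sum_erase _ (by simp), Finset.sum_erase _ (by simp), Fin.sum_univ_add,
      Fin.sum_univ_two, ← add_assoc]
    change (∑ j, (pt t (mov i) - pt t (mov j))⁻¹) + (pt t (mov i) - pt t (idxZero n))⁻¹
      + (pt t (mov i) - pt t (idxOne n))⁻¹ = _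
    simp only [pt_mov, pt_idxZero, pt_idxOne, sub_zero]
  rw [xBar, hsum]
  congr 1
  have hterm : ∑ j ∈ Finset.univ.erase i, coordX t i * (coordX t j - 1) /
      (coordX t i - coordX t j) = -(t i * ∑ j ∈ Finset.univ.erase i, (t i - t j)⁻¹) := by
    rw [Finset.mul_sum, ← Finset.sum_neg_distrib]
    refine Finset.sum_congr rfl fun j hj => ?_
    have hij : t i - t j ≠ 0 := by
      refine sub_ne_zero.2 fun h => (Finset.mem_erase.1 hj).1 ?_
      have h2 : mov i = mov j := ht (by rw [pt_mov, pt_mov, h])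
      exact (Fin.castAdd_injective n 2 h2).symm
    have hd : coordX t i - coordX t j = -(t i - t j) / ((t i - 1) * (t j - 1)) := by
      have hi := h1 i
      have hj := h1 j
      simp only [coordX]
      field_simp
      ring
    have hc : coordX t j - 1 = 1 / (t j - 1) := by
      have hj := h1 j
      simp only [coordX]
      field_simp
      ring
    rw [hd, hc, coordX]
    have hi := h1 i
    have hj := h1 j
    field_simp
  rw [hterm, coordX]
  have hi := h1 i
  have hi0 := h0 i
  generalize ∑ j ∈ Finset.univ.erase i, (t i - t j)⁻¹ = r
  rw [sub_zero, zero_sub]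
  field_simp
  ring

lemma sum_shift_sq_two (θ : Fin (n + 3) → ℂ) :
    ∑ k, shift θ (Pi.single (Fin.last (n + 2)) 2) k ^ 2 =
      ∑ k, θ k ^ 2 + 4 * (θ (Fin.last (n + 2)) + 1) := by
  have : ∀ k, shift θ (Pi.single (Fin.last (n + 2)) 2) k ^ 2 =
      θ k ^ 2 + if k = Fin.last (n + 2) then 4 * (θ k + 1) else 0 := by
    intro k
    simp only [shift, Pi.single_apply]
    split_ifs <;> push_cast <;> ring
  simp only [this, Finset.sum_add_distrib, Finset.sum_ite_eq', Finset.mem_univ, if_true]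

lemma sum_shift_sq_single (θ : Fin (n + 3) → ℂ) (k : Fin (n + 2)) :
    ∑ l, shift θ (Pi.single (Fin.last (n + 2)) 1 - Pi.single k.castSucc 1) l ^ 2 =
      ∑ l, θ l ^ 2 + (2 * θ (Fin.last (n + 2)) + 1) + (1 - 2 * θ k.castSucc) := by
  have : ∀ l, shift θ (Pi.single (Fin.last (n + 2)) 1 - Pi.single k.castSucc 1) l ^ 2 =
      θ l ^ 2 + (if l = Fin.last (n + 2) then 2 * θ l + 1 else 0) +
        if l = k.castSucc then 1 - 2 * θ l else 0 := by
    intro l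
    simp only [shift, Pi.sub_apply, Pi.single_apply]
    split_ifs with h1 h2
    · exact absurd (h2.symm.trans h1) (Fin.castSucc_ne_last k)
    all_goals push_cast; ring
  simp only [this, Finset.sum_add_distrib, Finset.sum_ite_eq', Finset.mem_univ, if_true]

lemma sum_hamConst_shift_two (θ : Fin (n + 3) → ℂ) (t : Fin n → ℂ) (i : Fin n) :
    ∑ j ∈ Finset.univ.erase (mov i),
        hamConst (shift θ (Pi.single (Fin.last (n + 2)) 2)) (mov i) j / (pt t (mov i) - pt t j) -
      ∑ j ∈ Finset.univ.erase (mov i), hamConst θ (mov i) j / (pt t (mov i) - pt t j) =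
    -(2 * (θ (Fin.last (n + 2)) + 1) / (((n : ℂ) + 1) * ((n : ℂ) + 2))) * recipSum t i := by
  rw [← Finset.sum_sub_distrib, recipSum, Finset.mul_sum]
  refine Finset.sum_congr rfl fun j _ => ?_
  have hs : ∀ l : Fin (n + 2),
      shift θ (Pi.single (Fin.last (n + 2)) 2) l.castSucc = θ l.castSucc := fun l => by
    simp [shift, Fin.castSucc_ne_last]
  rw [← sub_div, div_eq_mul_inv]
  congr 1
  simp only [hamConst, hs, sum_shift_sq_two]
  have h1 : (n : ℂ) + 1 ≠ 0 := by exact_mod_cast n.succ_ne_zero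
  have h2 : (n : ℂ) + 2 ≠ 0 := by exact_mod_cast (n + 1).succ_ne_zero
  field_simp
  ring

/-- The part independent of j comes from ∑ θ² and leads to X̄_i. The extra part at j = k leads to
Γ̄: its θ_i/2 combines with the -θ_i of `traceHam_of_transform_single` into -θ_i/2. -/
lemma hamConst_shift_single (θ : Fin (n + 3) → ℂ) {i j k : Fin (n + 2)} (hik : i ≠ k) :
    hamConst (shift θ (Pi.single (Fin.last (n + 2)) 1 - Pi.single k.castSucc 1)) i j =
      hamConst θ i j
        - (2 * θ (Fin.last (n + 2)) + 2 - 2 * θ k.castSucc) / (2 * ((n : ℂ) + 1) * ((n : ℂ) + 2))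
        + if j = k then θ i.castSucc / 2 + (1 - 2 * θ k.castSucc) / (2 * ((n : ℂ) + 1)) else 0 := by
  have hi : shift θ (Pi.single (Fin.last (n + 2)) 1 - Pi.single k.castSucc 1) i.castSucc =
      θ i.castSucc := by simp [shift, Fin.castSucc_ne_last, hik]
  have hj : shift θ (Pi.single (Fin.last (n + 2)) 1 - Pi.single k.castSucc 1) j.castSucc =
      θ j.castSucc - if j = k then 1 else 0 := by
    by_cases h : j = k <;> simp [shift, Fin.castSucc_ne_last, h, sub_eq_add_neg]
  simp only [hamConst, hi, hj, sum_shift_sq_single]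
  have h1 : (n : ℂ) + 1 ≠ 0 := by exact_mod_cast n.succ_ne_zero
  have h2 : (n : ℂ) + 2 ≠ 0 := by exact_mod_cast (n + 1).succ_ne_zero
  split_ifs with h
  · subst h
    field_simp
    ring
  · field_simp
    ring

lemma sum_hamConst_shift_single (θ : Fin (n + 3) → ℂ) (t : Fin n → ℂ) (i : Fin n)
    {k : Fin (n + 2)} (hik : mov i ≠ k) :
    ∑ j ∈ Finset.univ.erase (mov i),
        hamConst (shift θ (Pi.single (Fin.last (n + 2)) 1 - Pi.single k.castSucc 1)) (mov i) j /
          (pt t (mov i) - pt t j) =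
      ∑ j ∈ Finset.univ.erase (mov i), hamConst θ (mov i) j / (pt t (mov i) - pt t j)
        - (2 * θ (Fin.last (n + 2)) + 2 - 2 * θ k.castSucc) / (2 * ((n : ℂ) + 1) * ((n : ℂ) + 2))
          * recipSum t i
        + (θ (mov i).castSucc / 2 + (1 - 2 * θ k.castSucc) / (2 * ((n : ℂ) + 1))) /
          (pt t (mov i) - pt t k) := by
  have hk : k ∈ Finset.univ.erase (mov i) := Finset.mem_erase.2 ⟨hik.symm, Finset.mem_univ k⟩
  rw [recipSum, Finset.mul_sum, ← Finset.sum_sub_distrib]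
  have hite : (θ (mov i).castSucc / 2 + (1 - 2 * θ k.castSucc) / (2 * ((n : ℂ) + 1))) /
      (pt t (mov i) - pt t k) = ∑ j ∈ Finset.univ.erase (mov i), if j = k then
        (θ (mov i).castSucc / 2 + (1 - 2 * θ k.castSucc) / (2 * ((n : ℂ) + 1))) /
          (pt t (mov i) - pt t j) else 0 := by
    rw [Finset.sum_ite_eq', if_pos hk]
  rw [hite, ← Finset.sum_add_distrib]
  refine Finset.sum_congr rfl fun j _ => ?_
  rw [hamConst_shift_single θ hik]
  split_ifs <;> ring

end Garnier

/-! ### The formulas for q_i and q_i p_i -/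

theorem mainTheorem6 (n : ℕ) (θ : Fin (n + 3) → ℂ)
    (hθ : ∀ (j : Fin (n + 3)) (m : ℤ), θ j ≠ (m : ℂ))
    (U : Set (Fin n → ℂ)) (hU : IsOpen U)
    (hdist : ∀ t ∈ U, Function.Injective (Garnier.pt t))
    (A : (Fin n → ℂ) → Fin (n + 2) → Garnier.Mat2)
    (hA : Garnier.IsSchlesingerSolution θ U A)
    (τ₀ τ₁₃ τ₁ₘ₃ τ₁ₘ₂ : (Fin n → ℂ) → ℂ)
    (h₀ : Garnier.IsGarnierTau θ U A 0 τ₀)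
    (h₁₃ : Garnier.IsGarnierTau θ U A (Garnier.basisVec 0 + Garnier.basisVec 2) τ₁₃)
    (h₁ₘ₃ : Garnier.IsGarnierTau θ U A (Garnier.basisVec 0 - Garnier.basisVec 2) τ₁ₘ₃)
    (h₁ₘ₂ : Garnier.IsGarnierTau θ U A (Garnier.basisVec 0 - Garnier.basisVec 1) τ₁ₘ₂)
    (t : Fin n → ℂ) (ht : t ∈ U) (x : Fin n → ℂ) (hx : x = Garnier.coordX t)
    (hbInf : Garnier.bInf t (A t) ≠ 0) (i : Fin n) :
    Garnier.garnierQ t (A t) i =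
        -(1 / Garnier.eps θ 2) * (x i * (x i - 1)) *
            Garnier.dlog i (fun y => τ₁₃ y / τ₁ₘ₃ y) x
          - 2 * Garnier.xBar x i ∧
      (A t (Garnier.mov i) 0 1 ≠ 0 → A t (Garnier.idxZero n) 0 1 ≠ 0 →
        A t (Garnier.idxOne n) 0 1 ≠ 0 →
        Garnier.garnierQ t (A t) i * Garnier.garnierP t (A t) i =
          -x i * Garnier.dlog i (fun y => τ₁ₘ₂ y / τ₀ y) x
            + (Garnier.gammaBar θ (Garnier.epsMov i) 0
                - x i * Garnier.gammaBar θ (Garnier.epsMov i) 1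
                - (Garnier.eps θ 0 - Garnier.eps θ 1) * Garnier.xBar x i) / (x i - 1)) := by
  open Garnier in
  subst hx
  have hinj := hdist t ht
  have hres := hA.residueData t ht
  have ht0 : t i ≠ 0 := fun h => mov_ne_idxZero i (hinj (by rw [pt_mov, pt_idxZero, h]))
  have ht1 : t i - 1 ≠ 0 := fun h =>
    mov_ne_idxOne i (hinj (by rw [pt_mov, pt_idxOne, sub_eq_zero.1 h]))
  have hx1 : coordX t i - 1 = (t i - 1)⁻¹ := by
    simp only [coordX]
    field_simp
    ring
  have hxi : coordX t i = t i * (t i - 1)⁻¹ := div_eq_mul_inv _ _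
  have hn1 : (n : ℂ) + 1 ≠ 0 := by exact_mod_cast n.succ_ne_zero
  have hn2 : (n : ℂ) + 2 ≠ 0 := by exact_mod_cast (n + 1).succ_ne_zero
  constructor
  · obtain ⟨hne, B, hB, hd⟩ := h₁₃ t ht
    obtain ⟨hne', B', hB', hd'⟩ := h₁ₘ₃ t ht
    rw [garnierShift_add] at hB hd
    rw [garnierShift_sub_two] at hB' hd'
    -- ε_3 = θ_{n+3} + 1 is nonzero because θ_{n+3} is not the integer -1.
    have hε : θ (Fin.last (n + 2)) + 1 ≠ 0 := fun h =>
      hθ (Fin.last (n + 2)) (-1) (by push_cast; linear_combination h)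
    have hs0 : shift θ 0 = θ := by ext; simp [shift]
    rw [dlog_div hne hne' hd hd', xBar_coordX hinj, eps_two, hs0, schlesingerHam_eq,
      schlesingerHam_eq, traceHam_of_transform_two hθ hinj hres hB hbInf,
      traceHam_of_transform_zero hθ hinj hres hB', hx1, hxi, garnierQ]
    have hc := sum_hamConst_shift_two θ t i
    rw [sub_eq_iff_eq_add] at hc
    rw [hc]
    generalize ∑ j ∈ Finset.univ.erase (mov i), hamConst θ (mov i) j / (pt t (mov i) - pt t j) = c
    field_simp
    ring
  · intro hbi hb0 hb1
    obtain ⟨hne, B, hB, hd⟩ := h₁ₘ₂ t ht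
    obtain ⟨hne', B', hB', hd'⟩ := h₀ t ht
    rw [garnierShift_sub_one] at hB hd
    rw [garnierShift_zero] at hB' hd'
    rw [dlog_div hne hne' hd hd', xBar_coordX hinj, gammaBar, gammaBar, eps_zero, eps_one,
      eps_epsMov, schlesingerHam_eq, schlesingerHam_eq,
      traceHam_of_transform_single hθ hinj hres (mov_ne_idxOne i) hB hb1,
      traceHam_of_transform_single hθ hinj hres (mov_ne_idxZero i) hB' hb0,
      sum_hamConst_shift_single θ t i (mov_ne_idxOne i),
      sum_hamConst_shift_single θ t i (mov_ne_idxZero i), hx1, hxi, garnierQ, garnierP,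
      pt_mov, pt_idxZero, pt_idxOne, sub_zero]
    -- The unshifted constants are common to both Hamiltonians and cancel, as does the θ_{n+3}
    -- contribution; of the coefficients of X̄_i only ε_1 - ε_2 remains.
    generalize ∑ j ∈ Finset.univ.erase (mov i), hamConst θ (mov i) j / (t i - pt t j) = c
    field_simp
    ring
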